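/- Let $U\subset\mathbb R^2$ be a nonempty open set with coordinates $(x,y)$ and let $h,H:U\to\mathbb R$ be positive smooth functions with $$\Delta\ln H=(\ln H)_{xx}+(\ln H)_{yy}=\tfrac12h^2+H^2\quad\text{on }U.$$ Let $g_\Sigma=h^2(dx^2+dy^2)$, $\omega_\Sigma=h^2\,dx\wedge dy$, $l_2=(\ln H)_y$, $n_2=-(\ln H)_x$. On $M=U\times\{(z,t)\in\mathbb R^2:z<0\}$ put $$\theta_3=\sinh z\,dt-(-\sin t\cosh z\,H+\sinh z\,l_2)\,dx-(\cos t\cosh z\,H+\sinh z\,n_2)\,dy,$$ $$\theta_4=dz-\cos t\,H\,dx-\sin t\,H\,dy,\qquad g=\sinh^2(z/2)\,g_\Sigma+\theta_3^2+\theta_4^2 .$$ Then $g$ is a Riemannian metric on $M$, and $(M,g)$ admits a Kähler structure $\bar J$ with Kähler form $\bar\Omega=g(\bar J\cdot,\cdot)=\sinh^2(z/2)\,\omega_\Sigma+\theta_4\wedge\theta_3$ and a Hermitian structure $J$ with Kähler form $\Omega=g(J\cdot,\cdot)=\sinh^2(z/2)\,\omega_\Sigma+\theta_3\wedge\theta_4$;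 $J$ and $\bar J$ induce opposite orientations. The Ricci tensor of $(M,g)$ is $J$-invariant, $(M,g,J)$ is not locally conformally Kähler, and its Lee form $\theta$, defined by $d\Omega=2\theta\wedge\Omega$, is $\theta=-\alpha\theta_4$ with $\alpha=-\coth(z/2)$, that is $\theta=\coth(z/2)\,\theta_4$. Finally $(M,g,\bar J)$ is a QCH Kähler surface with respect to the distribution $\mathcal D=\mathrm{span}(\partial_z,\partial_t)$: $\mathcal D$ is $\bar J$-invariant and, for unit vectors $X\in T_pM$, the holomorphic curvature $g(R(X,\bar JX)\bar JX,X)$ depends only on $p$ and on the length $|X_{\mathcal D}|$ of the $g$-orthogonal projection of $X$ onto $\mathcal D$. -/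

import Mathlib

open scoped ContDiff Matrix

noncomputable section

namespace KahlerSurface

/-! Riemannian and Hermitian geometry on an open subset `M` of `ℝⁿ`, in the global coordinates.
Tensor fields are given by their components in the coordinate frame; they are functions on all of
`ℝⁿ`, of which only the values on `M` (and hence the derivatives at points of the open set `M`)
are used. Vectors are written as elements of `Fin n → ℝ`. -/

/-- The partial derivative `∂f/∂xⁱ` at `p`. -/
def pd {n : ℕ} (i : Fin n) (f : (Fin n → ℝ) → ℝ) (p : Fin n → ℝ) : ℝ :=
  fderiv ℝ f p (Pi.single i 1)

/-- The value `A(X, Y) = ∑ Aᵢⱼ Xⁱ Yʲ` of a bilinear form with component matrix `A`. -/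
def bilin {n : ℕ} (A : Matrix (Fin n) (Fin n) ℝ) (X Y : Fin n → ℝ) : ℝ :=
  X ⬝ᵥ (A *ᵥ Y)

/-- All components of a field of matrices are smooth on `M`. -/
def SmoothOn {n : ℕ} (M : Set (Fin n → ℝ)) (A : (Fin n → ℝ) → Matrix (Fin n) (Fin n) ℝ) : Prop :=
  ∀ i j, ContDiffOn ℝ ∞ (fun p => A p i j) M

/-- `g` is a Riemannian metric on `M`. -/
structure IsRiemannianMetric {n : ℕ} (M : Set (Fin n → ℝ))
    (g : (Fin n → ℝ) → Matrix (Fin n) (Fin n) ℝ) : Prop where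
  smooth : SmoothOn M g
  posDef : ∀ p ∈ M, (g p).PosDef

/-- The Christoffel symbols `Γᵏᵢⱼ = ½ gᵏˡ (∂ᵢ gⱼₗ + ∂ⱼ gᵢₗ - ∂ₗ gᵢⱼ)` of the Levi-Civita
connection, `∇_{∂ᵢ} ∂ⱼ = Γᵏᵢⱼ ∂ₖ`. -/
def christoffel {n : ℕ} (g : (Fin n → ℝ) → Matrix (Fin n) (Fin n) ℝ) (k i j : Fin n)
    (p : Fin n → ℝ) : ℝ :=
  (1 / 2) * ∑ l, (g p)⁻¹ k l *
    (pd i (fun q => g q j l) p + pd j (fun q => g q i l) p - pd l (fun q => g q i j) p)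

/-- The components `Rˡᵢⱼₖ` of the curvature tensor `R(X,Y)Z = ([∇_X, ∇_Y] - ∇_{[X,Y]}) Z`,
where `R(∂ᵢ, ∂ⱼ) ∂ₖ = Rˡᵢⱼₖ ∂ₗ`. -/
def riemann {n : ℕ} (g : (Fin n → ℝ) → Matrix (Fin n) (Fin n) ℝ) (l i j k : Fin n)
    (p : Fin n → ℝ) : ℝ :=
  pd i (christoffel g l j k) p - pd j (christoffel g l i k) p
    + ∑ m, (christoffel g l i m p * christoffel g m j k p
      - christoffel g l j m p * christoffel g m i k p)

/-- `R(X,Y)Z` at the point `p`. -/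
def curvature {n : ℕ} (g : (Fin n → ℝ) → Matrix (Fin n) (Fin n) ℝ) (p X Y Z : Fin n → ℝ) :
    Fin n → ℝ :=
  fun l => ∑ i, ∑ j, ∑ k, riemann g l i j k p * X i * Y j * Z k

/-- The Ricci tensor `ρ(Y,Z) = tr (X ↦ R(X,Y)Z)`. -/
def ricci {n : ℕ} (g : (Fin n → ℝ) → Matrix (Fin n) (Fin n) ℝ) (p : Fin n → ℝ) :
    Matrix (Fin n) (Fin n) ℝ :=
  Matrix.of fun j k => ∑ i, riemann g i i j k p

/-- The exterior derivative of a 2-form given by its components `ωᵢⱼ = ω(∂ᵢ, ∂ⱼ)`. -/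
def extd {n : ℕ} (w : (Fin n → ℝ) → Matrix (Fin n) (Fin n) ℝ) (p : Fin n → ℝ)
    (i j k : Fin n) : ℝ :=
  pd i (fun q => w q j k) p + pd j (fun q => w q k i) p + pd k (fun q => w q i j) p

/-- The wedge product of two covectors, `(a ∧ b)(X, Y) = a(X) b(Y) - a(Y) b(X)`. -/
def wedge {n : ℕ} (a b : Fin n → ℝ) : Matrix (Fin n) (Fin n) ℝ :=
  Matrix.vecMulVec a b - Matrix.vecMulVec b a

/-- The components of the wedge product of a covector with an alternating 2-form. -/
def wedgeTwo {n : ℕ} (a : Fin n → ℝ) (w : Matrix (Fin n) (Fin n) ℝ) (i j k : Fin n) : ℝ :=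
  a i * w j k + a j * w k i + a k * w i j

/-- The components of the Nijenhuis tensor
`N(X,Y) = [JX,JY] - J[JX,Y] - J[X,JY] - [X,Y]`, that is `N(∂ᵢ, ∂ⱼ) = Nᵏᵢⱼ ∂ₖ`, of the field of
endomorphisms `J ∂ᵢ = Jᵏᵢ ∂ₖ` with `J² = -1`. -/
def nijenhuis {n : ℕ} (J : (Fin n → ℝ) → Matrix (Fin n) (Fin n) ℝ) (k i j : Fin n)
    (p : Fin n → ℝ) : ℝ :=
  ∑ l, (J p l i * pd l (fun q => J q k j) p - J p l j * pd l (fun q => J q k i) p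
    + J p k l * (pd j (fun q => J q l i) p - pd i (fun q => J q l j) p))

/-- `(M, g, J)` is a Hermitian manifold: `g` is a Riemannian metric and `J` is a smooth
`g`-orthogonal almost complex structure with vanishing Nijenhuis tensor. -/
structure IsHermitian {n : ℕ} (M : Set (Fin n → ℝ))
    (g J : (Fin n → ℝ) → Matrix (Fin n) (Fin n) ℝ) : Prop where
  metric : IsRiemannianMetric M g
  smooth : SmoothOn M J
  sq : ∀ p ∈ M, J p * J p = -1
  orthogonal : ∀ p ∈ M, ∀ X Y, bilin (g p) (J p *ᵥ X) (J p *ᵥ Y) = bilin (g p) X Y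
  integrable : ∀ p ∈ M, ∀ k i j, nijenhuis J k i j p = 0

/-- The Kähler form `Ω(X,Y) = g(JX,Y)`, in components `Ωᵢⱼ = Jᵏᵢ gₖⱼ`. -/
def kahlerForm {n : ℕ} (g J : (Fin n → ℝ) → Matrix (Fin n) (Fin n) ℝ) (p : Fin n → ℝ) :
    Matrix (Fin n) (Fin n) ℝ :=
  (J p)ᵀ * g p

/-- `(M, g, J)` is a Kähler manifold: it is Hermitian with closed Kähler form. -/
structure IsKahler {n : ℕ} (M : Set (Fin n → ℝ))
    (g J : (Fin n → ℝ) → Matrix (Fin n) (Fin n) ℝ) : Prop where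
  hermitian : IsHermitian M g J
  closed : ∀ p ∈ M, ∀ i j k, extd (kahlerForm g J) p i j k = 0

/-- `(M, g, J)` is locally conformally Kähler: every point of `M` has an open neighbourhood on
which some conformal rescaling `e^σ g`, with `σ` smooth, is Kähler with respect to `J`. -/
def IsLCK {n : ℕ} (M : Set (Fin n → ℝ)) (g J : (Fin n → ℝ) → Matrix (Fin n) (Fin n) ℝ) : Prop :=
  ∀ p ∈ M, ∃ V : Set (Fin n → ℝ), IsOpen V ∧ p ∈ V ∧ V ⊆ M ∧
    ∃ σ : (Fin n → ℝ) → ℝ, ContDiffOn ℝ ∞ σ V ∧ IsKahler V (fun q => Real.exp (σ q) • g q) J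

/-- `θ` is a Lee form of `(M, g, J)`: it is smooth and `dΩ = 2 θ ∧ Ω` on `M`. (In real dimension
four this equation determines `θ`.) -/
def IsLeeForm {n : ℕ} (M : Set (Fin n → ℝ)) (g J : (Fin n → ℝ) → Matrix (Fin n) (Fin n) ℝ)
    (θ : (Fin n → ℝ) → Fin n → ℝ) : Prop :=
  ContDiffOn ℝ ∞ θ M ∧
    ∀ p ∈ M, ∀ i j k,
      extd (kahlerForm g J) p i j k = 2 * wedgeTwo (θ p) (kahlerForm g J p) i j k

/-- The Ricci tensor of `(M, g)` is `J`-invariant, `ρ(JX, JY) = ρ(X, Y)`. -/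
def RicciInvariant {n : ℕ} (M : Set (Fin n → ℝ))
    (g J : (Fin n → ℝ) → Matrix (Fin n) (Fin n) ℝ) : Prop :=
  ∀ p ∈ M, ∀ X Y, bilin (ricci g p) (J p *ᵥ X) (J p *ᵥ Y) = bilin (ricci g p) X Y

/-- Two almost complex structures on `M ⊆ ℝ⁴` induce opposite orientations: at each point, a basis
`X, JX, Y, JY` and a basis `Z, J'Z, W, J'W` always have opposite orientations. -/
def OppositeOrientation (M : Set (Fin 4 → ℝ))
    (J J' : (Fin 4 → ℝ) → Matrix (Fin 4) (Fin 4) ℝ) : Prop :=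
  ∀ p ∈ M, ∀ X Y Z W : Fin 4 → ℝ,
    LinearIndependent ℝ ![X, J p *ᵥ X, Y, J p *ᵥ Y] →
    LinearIndependent ℝ ![Z, J' p *ᵥ Z, W, J' p *ᵥ W] →
    (Matrix.of ![X, J p *ᵥ X, Y, J p *ᵥ Y]).det
      * (Matrix.of ![Z, J' p *ᵥ Z, W, J' p *ᵥ W]).det < 0

/-- `D` is a smooth distribution of rank `r` on `M`: locally it is spanned by `r` pointwise
linearly independent smooth vector fields. -/
def IsDistribution {n : ℕ} (M : Set (Fin n → ℝ)) (D : (Fin n → ℝ) → Submodule ℝ (Fin n → ℝ))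
    (r : ℕ) : Prop :=
  ∀ p ∈ M, ∃ V : Set (Fin n → ℝ), IsOpen V ∧ p ∈ V ∧ V ⊆ M ∧
    ∃ X : Fin r → (Fin n → ℝ) → Fin n → ℝ, (∀ a, ContDiffOn ℝ ∞ (X a) V) ∧
      ∀ q ∈ V, LinearIndependent ℝ (fun a => X a q) ∧
        D q = Submodule.span ℝ (Set.range fun a => X a q)

/-- `X'` is the orthogonal projection of `X` onto the subspace `D` with respect to the inner
product with matrix `A`. -/
def IsOrthProj {n : ℕ} (A : Matrix (Fin n) (Fin n) ℝ) (D : Submodule ℝ (Fin n → ℝ))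
    (X X' : Fin n → ℝ) : Prop :=
  X' ∈ D ∧ ∀ Y ∈ D, bilin A (X - X') Y = 0

/-- The holomorphic curvature `R(X, JX, JX, X) = g(R(X, JX)JX, X)` at `p`. -/
def holCurvature {n : ℕ} (g J : (Fin n → ℝ) → Matrix (Fin n) (Fin n) ℝ) (p X : Fin n → ℝ) : ℝ :=
  bilin (g p) (curvature g p X (J p *ᵥ X) (J p *ᵥ X)) X

/-- `(M, g, J)` is a QCH Kähler surface (quasi constant holomorphic curvature) with respect to
`D`: it is Kähler, `D` is a smooth `J`-invariant distribution of rank 2, and for unit vectors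
`X ∈ T_pM` the holomorphic curvature `R(X, JX, JX, X)` depends only on `p` and on the length
`|X_D|` of the orthogonal projection of `X` onto `D`. -/
structure IsQCH (M : Set (Fin 4 → ℝ)) (g J : (Fin 4 → ℝ) → Matrix (Fin 4) (Fin 4) ℝ)
    (D : (Fin 4 → ℝ) → Submodule ℝ (Fin 4 → ℝ)) : Prop where
  kahler : IsKahler M g J
  distribution : IsDistribution M D 2
  invariant : ∀ p ∈ M, ∀ X ∈ D p, J p *ᵥ X ∈ D p
  curvature : ∀ p ∈ M, ∀ X X' Y Y' : Fin 4 → ℝ,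
    bilin (g p) X X = 1 → bilin (g p) Y Y = 1 →
    IsOrthProj (g p) (D p) X X' → IsOrthProj (g p) (D p) Y Y' →
    √(bilin (g p) X' X') = √(bilin (g p) Y' Y') →
    holCurvature g J p X = holCurvature g J p Y

/-! The manifold `M = U × {(z, t) : z < 0}` with coordinates `(x, y, z, t) = (p 0, p 1, p 2, p 3)`,
and its metric. -/

/-- The projection `(x, y, z, t) ↦ (x, y)`. -/
def base (p : Fin 4 → ℝ) : Fin 2 → ℝ := ![p 0, p 1]

/-- `M = U × {(z, t) : z < 0}`. -/
def total (U : Set (Fin 2 → ℝ)) : Set (Fin 4 → ℝ) := {p | base p ∈ U ∧ p 2 < 0}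

/-- The flat Laplacian `f_xx + f_yy`. -/
def lap (f : (Fin 2 → ℝ) → ℝ) (q : Fin 2 → ℝ) : ℝ := pd 0 (pd 0 f) q + pd 1 (pd 1 f) q

/-- The function `l₂ = (ln H)_y`. -/
def l₂ (H : (Fin 2 → ℝ) → ℝ) (q : Fin 2 → ℝ) : ℝ := pd 1 (fun q => Real.log (H q)) q

/-- The function `n₂ = -(ln H)_x`. -/
def n₂ (H : (Fin 2 → ℝ) → ℝ) (q : Fin 2 → ℝ) : ℝ := -pd 0 (fun q => Real.log (H q)) q

/-- The coordinate coframe: `dcoord 0, …, dcoord 3` are `dx, dy, dz, dt`. -/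
def dcoord (i : Fin 4) : Fin 4 → ℝ := Pi.single i 1

/-- `θ₃ = sinh z dt - (-sin t cosh z H + sinh z l₂) dx - (cos t cosh z H + sinh z n₂) dy`. -/
def θ₃ (H : (Fin 2 → ℝ) → ℝ) (p : Fin 4 → ℝ) : Fin 4 → ℝ :=
  Real.sinh (p 2) • dcoord 3
    - (-Real.sin (p 3) * Real.cosh (p 2) * H (base p) + Real.sinh (p 2) * l₂ H (base p)) • dcoord 0
    - (Real.cos (p 3) * Real.cosh (p 2) * H (base p) + Real.sinh (p 2) * n₂ H (base p)) • dcoord 1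

/-- `θ₄ = dz - cos t H dx - sin t H dy`. -/
def θ₄ (H : (Fin 2 → ℝ) → ℝ) (p : Fin 4 → ℝ) : Fin 4 → ℝ :=
  dcoord 2 - (Real.cos (p 3) * H (base p)) • dcoord 0 - (Real.sin (p 3) * H (base p)) • dcoord 1

/-- The metric `g_Σ = h² (dx² + dy²)`, pulled back to `M`. -/
def metricBase (h : (Fin 2 → ℝ) → ℝ) (p : Fin 4 → ℝ) : Matrix (Fin 4) (Fin 4) ℝ :=
  h (base p) ^ 2 •
    (Matrix.vecMulVec (dcoord 0) (dcoord 0) + Matrix.vecMulVec (dcoord 1) (dcoord 1))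

/-- The volume form `ω_Σ = h² dx ∧ dy`, pulled back to `M`. -/
def volBase (h : (Fin 2 → ℝ) → ℝ) (p : Fin 4 → ℝ) : Matrix (Fin 4) (Fin 4) ℝ :=
  h (base p) ^ 2 • wedge (dcoord 0) (dcoord 1)

/-- The metric `g = sinh²(z/2) g_Σ + θ₃² + θ₄²`. -/
def metric (h H : (Fin 2 → ℝ) → ℝ) (p : Fin 4 → ℝ) : Matrix (Fin 4) (Fin 4) ℝ :=
  Real.sinh (p 2 / 2) ^ 2 • metricBase h p
    + Matrix.vecMulVec (θ₃ H p) (θ₃ H p) + Matrix.vecMulVec (θ₄ H p) (θ₄ H p)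

/-- The rank 2 distribution spanned by `∂_z` and `∂_t`. -/
def vertical (_p : Fin 4 → ℝ) : Submodule ℝ (Fin 4 → ℝ) :=
  Submodule.span ℝ {Pi.single 2 1, Pi.single 3 1}

end KahlerSurface

end

open KahlerSurface

/-!
The proof is a computation with Cartan's method of moving frames. Put
`a = H (cos t dx + sin t dy)`, `b = H (-sin t dx + cos t dy)` and `φ = dt - l₂ dx - n₂ dy`. Then
`da = φ ∧ b`, `db = -φ ∧ a`, and the differential equation for `H` says exactly that
`dφ = a ∧ b + ½ h² dx ∧ dy`. In these terms `θ₄ = dz - a` and `θ₃ = sinh z φ - cosh z b`.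

With respect to the orthonormal coframe `e₁ = sinh (z/2) h dx`, `e₂ = sinh (z/2) h dy`, `e₃ = θ₃`,
`e₄ = θ₄`, the Levi-Civita connection forms are `ω₁₄ = ω₂₃ = ½ cosh (z/2) h dx`,
`ω₂₄ = -ω₁₃ = ½ cosh (z/2) h dy`, `ω₃₄ = cosh z φ - sinh z b` and
`ω₁₂ = (ln h)_y dx - (ln h)_x dy - ½ φ - ½ ω₃₄` (`isMovingFrame`), and the curvature forms have
constant frame components apart from one function `K` (`curvForm_connForm`):
`Ω₁₂ = K e₁ ∧ e₂ + ½ e₃ ∧ e₄`, `Ω₃₄ = ½ e₁ ∧ e₂ - e₃ ∧ e₄`, `Ω₁₄ = Ω₂₃ = -¼ (e₁ ∧ e₄ + e₂ ∧ e₃)`,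
`Ω₂₄ = -Ω₁₃ = ¼ (e₁ ∧ e₃ - e₂ ∧ e₄)`.

Everything else is read off from this. The structures `J` and `Jbar` have constant components in
the frame, `e₁ ↦ e₂` and `e₃ ↦ ± e₄`. The connection forms commute with `Jbar`, so `Jbar` is
Kähler; their commutator with `J` satisfies `∇_{JX} J = J ∇_X J`, which gives integrability of `J`
(`IsMovingFrame.nijenhuis_eq_zero`), and its antisymmetrisation is the Lee form (`isLeeForm`). The
Ricci tensor is `diag (K - ½, K - ½, -3/2, -3/2)`, hence invariant (`ricci_metric`), and the
holomorphic curvature for `Jbar` is `K A² - 2 A B - B²`, where `A` and `B` are the squared lengths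
of the horizontal and vertical components (`holCurvature_frameJ`). Finally, a local conformal
Kähler rescaling `e^σ g` forces `dσ = -2θ`, whereas `θ` is not closed (`not_isLCK`).

The passage from the coordinate definitions of the Christoffel symbols and of the curvature to the
frame is made once, for an arbitrary orthonormal coframe in any dimension: if `E` is the matrix of
the coframe, then `E Γᵢ = ∂ᵢE + ωᵢE` (`IsMovingFrame.christoffel_eq`), and differentiating this
identity gives `Rᵢⱼ = E⁻¹ (dω + ω ∧ ω)ᵢⱼ E` (`IsMovingFrame.riemann_eq`).
-/

namespace KahlerSurface

section

variable {n : ℕ}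

/-! ### Calculus of partial derivatives -/

/-- The entrywise partial derivative `∂A/∂xⁱ` of a field of matrices. -/
noncomputable def pdMat (i : Fin n) (A : (Fin n → ℝ) → Matrix (Fin n) (Fin n) ℝ)
    (p : Fin n → ℝ) : Matrix (Fin n) (Fin n) ℝ :=
  Matrix.of fun a b => pd i (fun q => A q a b) p

theorem pd_congr {f f' : (Fin n → ℝ) → ℝ} {M : Set (Fin n → ℝ)} (hM : IsOpen M)
    (hf : ∀ p ∈ M, f p = f' p) {p : Fin n → ℝ} (hp : p ∈ M) (i : Fin n) : pd i f p = pd i f' p := by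
  have : f =ᶠ[nhds p] f' := Filter.eventually_of_mem (hM.mem_nhds hp) hf
  rw [pd, pd, this.fderiv_eq]

theorem pdMat_congr {A B : (Fin n → ℝ) → Matrix (Fin n) (Fin n) ℝ} {M : Set (Fin n → ℝ)}
    (hM : IsOpen M) (hf : ∀ p ∈ M, A p = B p) {p : Fin n → ℝ} (hp : p ∈ M) (i : Fin n) :
    pdMat i A p = pdMat i B p := by
  ext a b
  exact pd_congr hM (fun q hq => by rw [hf q hq]) hp i

theorem pd_mul {f f' : (Fin n → ℝ) → ℝ} {p : Fin n → ℝ} (hf : DifferentiableAt ℝ f p)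
    (hf' : DifferentiableAt ℝ f' p) (i : Fin n) :
    pd i (fun q => f q * f' q) p = pd i f p * f' p + f p * pd i f' p := by
  rw [pd, fderiv_fun_mul hf hf']
  simp [pd]
  ring

theorem pd_add {f f' : (Fin n → ℝ) → ℝ} {p : Fin n → ℝ} (hf : DifferentiableAt ℝ f p)
    (hf' : DifferentiableAt ℝ f' p) (i : Fin n) :
    pd i (fun q => f q + f' q) p = pd i f p + pd i f' p := by
  rw [pd, fderiv_fun_add hf hf']
  rfl

theorem pd_sum {ι : Type*} {s : Finset ι} {f : ι → (Fin n → ℝ) → ℝ} {p : Fin n → ℝ}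
    (hf : ∀ a ∈ s, DifferentiableAt ℝ (f a) p) (i : Fin n) :
    pd i (fun q => ∑ a ∈ s, f a q) p = ∑ a ∈ s, pd i (f a) p := by
  rw [pd, fderiv_fun_sum hf]
  simp [pd]

theorem pd_const (c : ℝ) (i : Fin n) (p : Fin n → ℝ) : pd i (fun _ => c) p = 0 := by
  simp [pd]

theorem pd_neg {n : ℕ} (i : Fin n) (f : (Fin n → ℝ) → ℝ) (p : Fin n → ℝ) :
    pd i (fun q => -f q) p = -pd i f p := by
  rw [pd, fderiv_fun_neg]
  rfl

theorem pd_pd_comm {f : (Fin n → ℝ) → ℝ} {M : Set (Fin n → ℝ)} (hM : IsOpen M)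
    (hf : ContDiffOn ℝ ∞ f M) {p : Fin n → ℝ} (hp : p ∈ M) (i j : Fin n) :
    pd i (pd j f) p = pd j (pd i f) p := by
  have hf' : ContDiffAt ℝ ∞ f p := hf.contDiffAt (hM.mem_nhds hp)
  have hd : DifferentiableAt ℝ (fderiv ℝ f) p :=
    (hf'.fderiv_right (m := ∞) (by simp)).differentiableAt (by simp)
  have key : ∀ k l : Fin n, pd k (pd l f) p
      = fderiv ℝ (fderiv ℝ f) p (Pi.single k 1) (Pi.single l 1) := fun k l => by
    have : pd l f = fun q => fderiv ℝ f q (Pi.single l 1) := rfl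
    rw [this, pd, fderiv_clm_apply hd (by fun_prop)]
    simp
  rw [key, key]
  exact (hf'.isSymmSndFDerivAt (by simpa using WithTop.coe_le_coe.2 (le_top (a := (2 : ℕ∞))))) _ _

theorem contDiffOn_pd {f : (Fin n → ℝ) → ℝ} {M : Set (Fin n → ℝ)} (hM : IsOpen M)
    (hf : ContDiffOn ℝ ∞ f M) (i : Fin n) : ContDiffOn ℝ ∞ (pd i f) M :=
  (hf.fderiv_of_isOpen hM (m := ∞) (by simp)).clm_apply contDiffOn_const

variable {M : Set (Fin n → ℝ)} {A B : (Fin n → ℝ) → Matrix (Fin n) (Fin n) ℝ} {p : Fin n → ℝ}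

theorem SmoothOn.differentiableAt (hA : SmoothOn M A) (hM : IsOpen M) (hp : p ∈ M) (a b : Fin n) :
    DifferentiableAt ℝ (fun q => A q a b) p :=
  ((hA a b).contDiffAt (hM.mem_nhds hp)).differentiableAt (by simp)

theorem SmoothOn.mul (hA : SmoothOn M A) (hB : SmoothOn M B) : SmoothOn M fun p => A p * B p := by
  intro i j
  simp only [Matrix.mul_apply]
  exact ContDiffOn.sum fun a _ => (hA i a).mul (hB a j)

theorem SmoothOn.add (hA : SmoothOn M A) (hB : SmoothOn M B) : SmoothOn M fun p => A p + B p :=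
  fun i j => (hA i j).add (hB i j)

theorem SmoothOn.transpose (hA : SmoothOn M A) : SmoothOn M fun p => (A p)ᵀ :=
  fun i j => hA j i

theorem smoothOn_const (M : Set (Fin n → ℝ)) (W : Matrix (Fin n) (Fin n) ℝ) :
    SmoothOn M fun _ => W :=
  fun _ _ => contDiffOn_const

theorem SmoothOn.pdMat (hA : SmoothOn M A) (hM : IsOpen M) (i : Fin n) : SmoothOn M (pdMat i A) :=
  fun a b => contDiffOn_pd hM (hA a b) i

theorem pdMat_mul (hA : SmoothOn M A) (hB : SmoothOn M B) (hM : IsOpen M) (hp : p ∈ M)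
    (i : Fin n) : pdMat i (fun q => A q * B q) p = pdMat i A p * B p + A p * pdMat i B p := by
  ext a b
  simp only [pdMat, Matrix.of_apply, Matrix.mul_apply, Matrix.add_apply]
  rw [pd_sum fun c _ => (hA.differentiableAt hM hp a c).fun_mul (hB.differentiableAt hM hp c b),
    ← Finset.sum_add_distrib]
  exact Finset.sum_congr rfl fun c _ =>
    pd_mul (hA.differentiableAt hM hp a c) (hB.differentiableAt hM hp c b) i

theorem pdMat_add (hA : SmoothOn M A) (hB : SmoothOn M B) (hM : IsOpen M) (hp : p ∈ M)
    (i : Fin n) : pdMat i (fun q => A q + B q) p = pdMat i A p + pdMat i B p := by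
  ext a b
  exact pd_add (hA.differentiableAt hM hp a b) (hB.differentiableAt hM hp a b) i

theorem pdMat_const (W : Matrix (Fin n) (Fin n) ℝ) (i : Fin n) : pdMat i (fun _ => W) p = 0 := by
  ext a b
  exact pd_const _ _ _

theorem pdMat_transpose (i : Fin n) : pdMat i (fun q => (A q)ᵀ) p = (pdMat i A p)ᵀ := rfl

theorem pdMat_pdMat_comm (hA : SmoothOn M A) (hM : IsOpen M) (hp : p ∈ M) (i j : Fin n) :
    pdMat i (pdMat j A) p = pdMat j (pdMat i A) p := by
  ext a b
  exact pd_pd_comm hM (hA a b) hp i j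

/-! ### Orthonormal moving frames -/

/-- An orthonormal coframe on `M` together with its Levi-Civita connection forms. The rows of `E`
are the covectors `eᵃ` of the coframe, the columns of `F` are the dual vector fields, and
`ψ i = (ψᵃ_b(∂ᵢ))` is a matrix of one-forms, skew-symmetric and satisfying Cartan's first
structure equation `deᵃ = -ψᵃ_b ∧ eᵇ`. The metric is `Eᵀ E`. -/
structure IsMovingFrame (M : Set (Fin n → ℝ)) (E F : (Fin n → ℝ) → Matrix (Fin n) (Fin n) ℝ)
    (ψ : Fin n → (Fin n → ℝ) → Matrix (Fin n) (Fin n) ℝ) : Prop where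
  smooth : SmoothOn M E
  smooth_dual : SmoothOn M F
  smooth_conn : ∀ i, SmoothOn M (ψ i)
  mul_dual : ∀ p ∈ M, E p * F p = 1
  skew : ∀ p ∈ M, ∀ i, (ψ i p)ᵀ = -ψ i p
  torsion : ∀ p ∈ M, ∀ a i j, pd i (fun q => E q a j) p - pd j (fun q => E q a i) p
    = (ψ j p * E p) a i - (ψ i p * E p) a j

/-- The matrix `∂ᵢE + ψᵢE`, whose `(a, j)` entry is `eᵃ(∇_{∂ᵢ} ∂ⱼ)`. -/
noncomputable def covCoframe (E : (Fin n → ℝ) → Matrix (Fin n) (Fin n) ℝ)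
    (ψ : Fin n → (Fin n → ℝ) → Matrix (Fin n) (Fin n) ℝ) (i : Fin n) (p : Fin n → ℝ) :
    Matrix (Fin n) (Fin n) ℝ :=
  pdMat i E p + ψ i p * E p

/-- The components `Ωᵃ_b(∂ᵢ, ∂ⱼ)` of the curvature forms `dψ + ψ ∧ ψ`. -/
noncomputable def curvForm (ψ : Fin n → (Fin n → ℝ) → Matrix (Fin n) (Fin n) ℝ) (i j : Fin n)
    (p : Fin n → ℝ) : Matrix (Fin n) (Fin n) ℝ :=
  pdMat i (ψ j) p - pdMat j (ψ i) p + (ψ i p * ψ j p - ψ j p * ψ i p)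

namespace IsMovingFrame

variable {E F : (Fin n → ℝ) → Matrix (Fin n) (Fin n) ℝ}
  {ψ : Fin n → (Fin n → ℝ) → Matrix (Fin n) (Fin n) ℝ}

theorem dual_mul (hf : IsMovingFrame M E F ψ) (hp : p ∈ M) : F p * E p = 1 :=
  mul_eq_one_comm.mp (hf.mul_dual p hp)

theorem inv_metric (hf : IsMovingFrame M E F ψ) (hp : p ∈ M) :
    ((E p)ᵀ * E p)⁻¹ = F p * (F p)ᵀ := by
  apply Matrix.inv_eq_right_inv
  rw [Matrix.mul_assoc, ← Matrix.mul_assoc (E p), hf.mul_dual p hp, Matrix.one_mul,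
    ← Matrix.transpose_mul, hf.dual_mul hp, Matrix.transpose_one]

theorem covCoframe_symm (hf : IsMovingFrame M E F ψ) (hp : p ∈ M) (a i j : Fin n) :
    covCoframe E ψ i p a j = covCoframe E ψ j p a i := by
  have := hf.torsion p hp a i j
  simp only [covCoframe, pdMat, Matrix.add_apply, Matrix.of_apply]
  linarith

theorem smooth_covCoframe (hf : IsMovingFrame M E F ψ) (hM : IsOpen M) (i : Fin n) :
    SmoothOn M (covCoframe E ψ i) :=
  (hf.smooth.pdMat hM i).add ((hf.smooth_conn i).mul hf.smooth)

theorem pdMat_coframe (i : Fin n) : pdMat i E p = covCoframe E ψ i p - ψ i p * E p := by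
  simp [covCoframe]

/-- The derivative of a bilinear form `Eᵀ W E` with constant frame components `W`. -/
theorem pdMat_bilinear (hf : IsMovingFrame M E F ψ) (hM : IsOpen M) (hp : p ∈ M)
    (W : Matrix (Fin n) (Fin n) ℝ) (i : Fin n) :
    pdMat i (fun q => (E q)ᵀ * W * E q) p
      = (covCoframe E ψ i p)ᵀ * W * E p + (E p)ᵀ * W * covCoframe E ψ i p
        + (E p)ᵀ * (ψ i p * W - W * ψ i p) * E p := by
  rw [pdMat_mul (hf.smooth.transpose.mul (smoothOn_const M W)) hf.smooth hM hp,
    pdMat_mul hf.smooth.transpose (smoothOn_const M W) hM hp, pdMat_const, pdMat_transpose,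
    pdMat_coframe (ψ := ψ), Matrix.transpose_sub, Matrix.transpose_mul, hf.skew p hp]
  noncomm_ring

theorem christoffel_eq (hf : IsMovingFrame M E F ψ) (hM : IsOpen M) (hp : p ∈ M) (k i j : Fin n) :
    christoffel (fun q => (E q)ᵀ * E q) k i j p = (F p * covCoframe E ψ i p) k j := by
  have hd : ∀ i j l, pd i (fun q => ((E q)ᵀ * E q) j l) p
      = ((covCoframe E ψ i p)ᵀ * E p) j l + ((covCoframe E ψ i p)ᵀ * E p) l j := fun i j l => by
    have := congrFun (congrFun (hf.pdMat_bilinear hM hp 1 i) j) l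
    simp only [mul_one, one_mul, sub_self, mul_zero, zero_mul, add_zero] at this
    refine this.trans ?_
    rw [Matrix.add_apply, ← Matrix.transpose_apply ((covCoframe E ψ i p)ᵀ * E p) j l,
      Matrix.transpose_mul, Matrix.transpose_transpose]
  have hs : ∀ i j l, ((covCoframe E ψ i p)ᵀ * E p) j l = ((covCoframe E ψ j p)ᵀ * E p) i l :=
    fun i j l => by
      simp only [Matrix.mul_apply, Matrix.transpose_apply]
      exact Finset.sum_congr rfl fun a _ => by rw [hf.covCoframe_symm hp]
  have hsum : ∀ l, pd i (fun q => ((E q)ᵀ * E q) j l) p + pd j (fun q => ((E q)ᵀ * E q) i l) p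
      - pd l (fun q => ((E q)ᵀ * E q) i j) p = 2 * ((E p)ᵀ * covCoframe E ψ i p) l j := fun l => by
    have ht : ((E p)ᵀ * covCoframe E ψ i p) l j = ((covCoframe E ψ i p)ᵀ * E p) j l := by
      simp [Matrix.mul_apply, mul_comm]
    rw [hd, hd, hd, hs j i l, hs l i j, hs l j i, ht]
    ring
  rw [christoffel, hf.inv_metric hp]
  simp only [hsum]
  have : (F p * (F p)ᵀ * ((E p)ᵀ * covCoframe E ψ i p)) k j = (F p * covCoframe E ψ i p) k j := by
    rw [Matrix.mul_assoc, ← Matrix.mul_assoc (F p)ᵀ, ← Matrix.transpose_mul, hf.mul_dual p hp,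
      Matrix.transpose_one, Matrix.one_mul]
  rw [← this, Matrix.mul_apply (M := F p * (F p)ᵀ), Finset.mul_sum]
  exact Finset.sum_congr rfl fun l _ => by ring

/-- Cartan's second structure equation: differentiating `E Γᵢ = ∂ᵢE + ψᵢE` shows that the
curvature of `Γ` is conjugate under `E` to `dψ + ψ ∧ ψ`. -/
theorem riemann_eq (hf : IsMovingFrame M E F ψ) (hM : IsOpen M) (hp : p ∈ M) (l i j k : Fin n) :
    riemann (fun q => (E q)ᵀ * E q) l i j k p = (F p * curvForm ψ i j p * E p) l k := by
  set Γ : Fin n → (Fin n → ℝ) → Matrix (Fin n) (Fin n) ℝ := fun i q => F q * covCoframe E ψ i q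
  have hΓ : ∀ i, SmoothOn M (Γ i) := fun i => hf.smooth_dual.mul (hf.smooth_covCoframe hM i)
  have hE : ∀ q ∈ M, ∀ i, E q * Γ i q = covCoframe E ψ i q := fun q hq i => by
    rw [← Matrix.mul_assoc, hf.mul_dual q hq, Matrix.one_mul]
  have hdE : ∀ i j, E p * pdMat i (Γ j) p = pdMat i (pdMat j E) p + pdMat i (ψ j) p * E p
      + ψ j p * pdMat i E p - pdMat i E p * Γ j p := fun i j => by
    have h1 : pdMat i (fun q => E q * Γ j q) p = pdMat i (covCoframe E ψ j) p :=
      pdMat_congr hM (fun q hq => hE q hq j) hp i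
    have h2 : pdMat i (covCoframe E ψ j) p = pdMat i (pdMat j E) p
        + (pdMat i (ψ j) p * E p + ψ j p * pdMat i E p) := by
      rw [← pdMat_mul (hf.smooth_conn j) hf.smooth hM hp i]
      exact pdMat_add (hf.smooth.pdMat hM j) ((hf.smooth_conn j).mul hf.smooth) hM hp i
    rw [pdMat_mul hf.smooth (hΓ j) hM hp, h2] at h1
    rw [eq_sub_iff_add_eq, add_comm, h1, add_assoc]
  have hc : E p * (pdMat i (Γ j) p - pdMat j (Γ i) p + (Γ i p * Γ j p - Γ j p * Γ i p))
      = curvForm ψ i j p * E p := by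
    have e : ∀ i j, E p * (Γ i p * Γ j p)
        = pdMat i E p * Γ j p + ψ i p * pdMat j E p + ψ i p * ψ j p * E p := fun i j => by
      rw [← Matrix.mul_assoc, hE p hp, covCoframe, Matrix.add_mul, Matrix.mul_assoc, hE p hp,
        covCoframe]
      noncomm_ring
    rw [Matrix.mul_add, Matrix.mul_sub, Matrix.mul_sub, e, e, hdE, hdE,
      pdMat_pdMat_comm hf.smooth hM hp i j, curvForm]
    noncomm_ring
  have hr : riemann (fun q => (E q)ᵀ * E q) l i j k p
      = (pdMat i (Γ j) p - pdMat j (Γ i) p + (Γ i p * Γ j p - Γ j p * Γ i p)) l k := by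
    simp only [riemann, Matrix.add_apply, Matrix.sub_apply, Matrix.mul_apply (M := Γ i p),
      Matrix.mul_apply (M := Γ j p), ← Finset.sum_sub_distrib]
    congr 1
    · congr 1 <;> exact pd_congr hM (fun q hq => hf.christoffel_eq hM hq _ _ _) hp _
    · simp only [hf.christoffel_eq hM hp]
      rfl
  rw [hr, Matrix.mul_assoc (F p) (curvForm ψ i j p), ← hc, ← Matrix.mul_assoc (F p) (E p),
    hf.dual_mul hp, Matrix.one_mul]

/-- The exterior derivative of a two-form with constant frame components `W`: only the failure of
the connection forms to commute with `W` contributes. -/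
theorem extd_eq (hf : IsMovingFrame M E F ψ) (hM : IsOpen M) (hp : p ∈ M)
    {W : Matrix (Fin n) (Fin n) ℝ} (hW : Wᵀ = -W) (i j k : Fin n) :
    extd (fun q => (E q)ᵀ * W * E q) p i j k
      = ((E p)ᵀ * (ψ i p * W - W * ψ i p) * E p) j k
        + ((E p)ᵀ * (ψ j p * W - W * ψ j p) * E p) k i
        + ((E p)ᵀ * (ψ k p * W - W * ψ k p) * E p) i j := by
  have hs : ∀ i j k, ((covCoframe E ψ i p)ᵀ * W * E p) j k
      = ((covCoframe E ψ j p)ᵀ * W * E p) i k := fun i j k => by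
    simp only [Matrix.mul_assoc, Matrix.mul_apply (M := (_)ᵀ), Matrix.transpose_apply]
    exact Finset.sum_congr rfl fun a _ => by rw [hf.covCoframe_symm hp]
  have ht : ∀ i j k, ((E p)ᵀ * W * covCoframe E ψ i p) j k
      = -((covCoframe E ψ i p)ᵀ * W * E p) k j := fun i j k => by
    have : ((E p)ᵀ * W * covCoframe E ψ i p)ᵀ = -((covCoframe E ψ i p)ᵀ * W * E p) := by
      simp [Matrix.transpose_mul, hW, Matrix.mul_assoc]
    exact congrFun (congrFun this k) j
  have hd : ∀ i j k, pd i (fun q => ((E q)ᵀ * W * E q) j k) p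
      = ((covCoframe E ψ i p)ᵀ * W * E p) j k - ((covCoframe E ψ i p)ᵀ * W * E p) k j
        + ((E p)ᵀ * (ψ i p * W - W * ψ i p) * E p) j k := fun i j k => by
    have := congrFun (congrFun (hf.pdMat_bilinear hM hp W i) j) k
    rw [Matrix.add_apply, Matrix.add_apply, ht, ← sub_eq_add_neg] at this
    exact this
  rw [extd, hd, hd, hd, hs i j k, hs i k j, hs j k i]
  ring

/-- An almost complex structure `J = F J₀ E` with constant frame components `J₀` is integrable as
soon as its covariant derivative satisfies `∇_{JX} J = J ∇_X J`. -/
theorem nijenhuis_eq_zero (hf : IsMovingFrame M E F ψ) (hM : IsOpen M) (hp : p ∈ M)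
    {J₀ : Matrix (Fin n) (Fin n) ℝ} (hJ : J₀ * J₀ = -1)
    (hψ : ∀ i, ∑ l, (F p * J₀ * E p) l i • (ψ l p * J₀ - J₀ * ψ l p)
      = J₀ * (ψ i p * J₀ - J₀ * ψ i p)) (k i j : Fin n) :
    nijenhuis (fun q => F q * J₀ * E q) k i j p = 0 := by
  set J : (Fin n → ℝ) → Matrix (Fin n) (Fin n) ℝ := fun q => F q * J₀ * E q with hJdef
  have hJs : SmoothOn M J := (hf.smooth_dual.mul (smoothOn_const M J₀)).mul hf.smooth
  have hEJ : ∀ q ∈ M, E q * J q = J₀ * E q := fun q hq => by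
    rw [hJdef]
    simp only
    rw [← Matrix.mul_assoc, ← Matrix.mul_assoc, hf.mul_dual q hq, Matrix.one_mul]
  have hdJ : ∀ l, E p * pdMat l J p = J₀ * covCoframe E ψ l p - covCoframe E ψ l p * J p
      + (ψ l p * J₀ - J₀ * ψ l p) * E p := fun l => by
    have h1 : pdMat l (fun q => E q * J q) p = pdMat l (fun q => J₀ * E q) p :=
      pdMat_congr hM hEJ hp l
    rw [pdMat_mul hf.smooth hJs hM hp, pdMat_mul (smoothOn_const M J₀) hf.smooth hM hp,
      pdMat_const, Matrix.zero_mul, zero_add, pdMat_coframe (ψ := ψ), Matrix.sub_mul,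
      Matrix.mul_assoc, hEJ p hp] at h1
    rw [← eq_sub_iff_add_eq'] at h1
    rw [h1]
    noncomm_ring
  -- `J` contracted with the direction of differentiation, in frame components.
  have h1 : ∀ a i j, ∑ l, J p l i * (E p * pdMat l J p) a j
      = (J₀ * covCoframe E ψ j p * J p) a i - ∑ l, J p l i * (covCoframe E ψ l p * J p) a j
        + (J₀ * (ψ i p * J₀ - J₀ * ψ i p) * E p) a j := fun a i j => by
    have e1 : ∑ l, J p l i * (J₀ * covCoframe E ψ l p) a j
        = (J₀ * covCoframe E ψ j p * J p) a i := by
      rw [Matrix.mul_apply]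
      refine Finset.sum_congr rfl fun l _ => ?_
      rw [mul_comm, Matrix.mul_apply, Matrix.mul_apply]
      simp only [hf.covCoframe_symm hp _ l j]
    have e2 : ∑ l, J p l i * ((ψ l p * J₀ - J₀ * ψ l p) * E p) a j
        = (J₀ * (ψ i p * J₀ - J₀ * ψ i p) * E p) a j := by
      rw [← hψ i, Finset.sum_mul, Matrix.sum_apply]
      simp only [Matrix.smul_mul, Matrix.smul_apply, smul_eq_mul]
      rfl
    rw [← e1, ← e2, ← Finset.sum_sub_distrib, ← Finset.sum_add_distrib]
    refine Finset.sum_congr rfl fun l _ => ?_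
    rw [hdJ, Matrix.add_apply, Matrix.sub_apply]
    ring
  have hswap : ∀ a i j, ∑ l, J p l i * (covCoframe E ψ l p * J p) a j
      = ∑ l, J p l j * (covCoframe E ψ l p * J p) a i := fun a i j => by
    simp only [Matrix.mul_apply (M := covCoframe E ψ _ p), Finset.mul_sum]
    rw [Finset.sum_comm]
    refine Finset.sum_congr rfl fun l _ => Finset.sum_congr rfl fun m _ => ?_
    rw [hf.covCoframe_symm hp a m l]
    ring
  have h2 : ∀ a i j, (E p * (J p * pdMat j J p)) a i
      = -covCoframe E ψ j p a i - (J₀ * covCoframe E ψ j p * J p) a i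
        + (J₀ * (ψ j p * J₀ - J₀ * ψ j p) * E p) a i := fun a i j => by
    have : E p * (J p * pdMat j J p) = -covCoframe E ψ j p - J₀ * covCoframe E ψ j p * J p
        + J₀ * (ψ j p * J₀ - J₀ * ψ j p) * E p := by
      rw [← Matrix.mul_assoc, hEJ p hp, Matrix.mul_assoc, hdJ, Matrix.mul_add, Matrix.mul_sub,
        ← Matrix.mul_assoc, hJ]
      noncomm_ring
    rw [this]
    rfl
  have hE : ∀ a, ∑ k, E p a k * nijenhuis J k i j p = 0 := fun a => by
    have e3 : ∀ i j, ∑ k, E p a k * ∑ l, J p l i * pd l (fun q => J q k j) p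
        = ∑ l, J p l i * (E p * pdMat l J p) a j := fun i j => by
      simp only [Matrix.mul_apply (M := E p), Finset.mul_sum, pdMat, Matrix.of_apply]
      rw [Finset.sum_comm]
      exact Finset.sum_congr rfl fun l _ => Finset.sum_congr rfl fun m _ => by ring
    have e4 : ∀ i j, ∑ k, E p a k * ∑ l, J p k l * pd j (fun q => J q l i) p
        = (E p * (J p * pdMat j J p)) a i := fun i j => by
      rw [Matrix.mul_apply]
      refine Finset.sum_congr rfl fun k _ => ?_
      rw [Matrix.mul_apply]
      rfl
    simp only [nijenhuis, mul_sub, Finset.sum_add_distrib, Finset.sum_sub_distrib, mul_add]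
    rw [e3, e3, e4, e4, h1, h1, h2, h2, hswap a i j, hf.covCoframe_symm hp a i j]
    ring
  have hz : F p *ᵥ (E p *ᵥ fun k => nijenhuis J k i j p) = 0 := by
    have : (E p *ᵥ fun k => nijenhuis J k i j p) = 0 := funext hE
    rw [this, Matrix.mulVec_zero]
  rw [Matrix.mulVec_mulVec, hf.dual_mul hp, Matrix.one_mulVec] at hz
  exact congrFun hz k

end IsMovingFrame

end

section

variable {n : ℕ} {M : Set (Fin n → ℝ)} {E F : (Fin n → ℝ) → Matrix (Fin n) (Fin n) ℝ}
  {ψ : Fin n → (Fin n → ℝ) → Matrix (Fin n) (Fin n) ℝ} {p : Fin n → ℝ}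
  {R : Fin n → Fin n → Matrix (Fin n) (Fin n) ℝ}

/-! ### Curvature in frame components -/

theorem bilin_mulVec (A B C : Matrix (Fin n) (Fin n) ℝ) (X Y : Fin n → ℝ) :
    bilin A (B *ᵥ X) (C *ᵥ Y) = bilin (Bᵀ * A * C) X Y := by
  rw [bilin, bilin, Matrix.mulVec_mulVec, ← Matrix.vecMul_transpose, ← Matrix.dotProduct_mulVec,
    Matrix.mulVec_mulVec, Matrix.mul_assoc]

theorem bilin_one (X Y : Fin n → ℝ) : bilin 1 X Y = X ⬝ᵥ Y := by
  rw [bilin, Matrix.one_mulVec]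

theorem bilin_transpose_mul_self (E : Matrix (Fin n) (Fin n) ℝ) (X Y : Fin n → ℝ) :
    bilin (Eᵀ * E) X Y = (E *ᵥ X) ⬝ᵥ (E *ᵥ Y) := by
  rw [← bilin_one, bilin_mulVec, Matrix.mul_one]

theorem bilin_eq_sum (A : Matrix (Fin n) (Fin n) ℝ) (X Y : Fin n → ℝ) :
    bilin A X Y = ∑ i, ∑ j, A i j * X i * Y j := by
  simp only [bilin, dotProduct, Matrix.mulVec, Finset.mul_sum]
  exact Finset.sum_congr rfl fun i _ => Finset.sum_congr rfl fun j _ => by ring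

theorem IsMovingFrame.curvForm_skew (hf : IsMovingFrame M E F ψ) (hM : IsOpen M) (hp : p ∈ M)
    (i j : Fin n) : (curvForm ψ i j p)ᵀ = -curvForm ψ i j p := by
  have h : ∀ i j, (pdMat i (ψ j) p)ᵀ = -pdMat i (ψ j) p := fun i j => by
    rw [← pdMat_transpose, pdMat_congr hM (fun q hq => hf.skew q hq j) hp]
    ext a b
    exact pd_neg _ _ _
  simp only [curvForm, Matrix.transpose_add, Matrix.transpose_sub, Matrix.transpose_mul, h,
    hf.skew p hp]
  noncomm_ring

/-- The Ricci tensor in terms of the frame components `R a b c d = Ωᵃ_b(e_c, e_d)` of the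
curvature. -/
theorem IsMovingFrame.ricci_eq (hf : IsMovingFrame M E F ψ) (hM : IsOpen M) (hp : p ∈ M)
    (hR : ∀ i j a b, curvForm ψ i j p a b = ((E p)ᵀ * R a b * E p) i j) :
    ricci (fun q => (E q)ᵀ * E q) p
      = (E p)ᵀ * (Matrix.of fun d b => ∑ a, R a b a d) * E p := by
  have hc : ∀ a b j, ∑ i, F p i a * ((E p)ᵀ * R a b * E p) i j = (R a b * E p) a j :=
    fun a b j => by
      have : (F p)ᵀ * ((E p)ᵀ * R a b * E p) = R a b * E p := by
        rw [Matrix.mul_assoc, ← Matrix.mul_assoc (F p)ᵀ, ← Matrix.transpose_mul, hf.mul_dual p hp,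
          Matrix.transpose_one, Matrix.one_mul]
      rw [← this, Matrix.mul_apply]
      rfl
  ext j k
  simp only [ricci, Matrix.of_apply, hf.riemann_eq hM hp, Matrix.mul_assoc (F p)]
  calc ∑ i, (F p * (curvForm ψ i j p * E p)) i k
      = ∑ a, ∑ b, (∑ i, F p i a * ((E p)ᵀ * R a b * E p) i j) * E p b k := by
        simp only [Matrix.mul_apply (M := F p), Matrix.mul_apply (M := curvForm ψ _ j p), hR,
          Finset.mul_sum, Finset.sum_mul]
        rw [Finset.sum_comm]
        refine Finset.sum_congr rfl fun a _ => ?_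
        rw [Finset.sum_comm]
        exact Finset.sum_congr rfl fun b _ => Finset.sum_congr rfl fun i _ => by ring
    _ = _ := by
        simp only [hc]
        simp only [Matrix.mul_apply, Matrix.of_apply, Matrix.transpose_apply, Finset.mul_sum,
          Finset.sum_mul]
        rw [Finset.sum_comm]
        refine Finset.sum_congr rfl fun b _ => ?_
        rw [Finset.sum_comm]
        exact Finset.sum_congr rfl fun d _ => Finset.sum_congr rfl fun a _ => by ring

/-- `g(R(X, Y) Z, T) = ∑ Ωᵃ_b(X, Y) Zᵇ Tᵃ` in frame components. -/
theorem IsMovingFrame.bilin_curvature (hf : IsMovingFrame M E F ψ) (hM : IsOpen M) (hp : p ∈ M)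
    (hR : ∀ i j a b, curvForm ψ i j p a b = ((E p)ᵀ * R a b * E p) i j) (X Y Z T : Fin n → ℝ) :
    bilin ((E p)ᵀ * E p) (curvature (fun q => (E q)ᵀ * E q) p X Y Z) T
      = ∑ a, ∑ b, bilin (R a b) (E p *ᵥ X) (E p *ᵥ Y) * (E p *ᵥ T) a * (E p *ᵥ Z) b := by
  have hc : E p *ᵥ curvature (fun q => (E q)ᵀ * E q) p X Y Z
      = fun a => ∑ b, bilin (R a b) (E p *ᵥ X) (E p *ᵥ Y) * (E p *ᵥ Z) b := by
    have h1 : curvature (fun q => (E q)ᵀ * E q) p X Y Z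
        = F p *ᵥ ∑ i, ∑ j, (X i * Y j) • (curvForm ψ i j p *ᵥ (E p *ᵥ Z)) := by
      ext l
      simp only [Matrix.mulVec_sum, Finset.sum_apply, Matrix.mulVec_smul, Pi.smul_apply,
        smul_eq_mul, Matrix.mulVec_mulVec, curvature, hf.riemann_eq hM hp, ← Matrix.mul_assoc]
      refine Finset.sum_congr rfl fun i _ => Finset.sum_congr rfl fun j _ => ?_
      rw [Matrix.mulVec, dotProduct, Finset.mul_sum]
      exact Finset.sum_congr rfl fun k _ => by ring
    rw [h1, Matrix.mulVec_mulVec, hf.mul_dual p hp, Matrix.one_mulVec]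
    ext a
    have hb : ∀ b, bilin (R a b) (E p *ᵥ X) (E p *ᵥ Y)
        = ∑ i, ∑ j, curvForm ψ i j p a b * X i * Y j := fun b => by
      rw [bilin_mulVec, bilin_eq_sum]
      simp only [hR]
    simp only [hb, Finset.sum_mul, Finset.sum_apply, Pi.smul_apply, smul_eq_mul]
    rw [Finset.sum_comm (s := Finset.univ (α := Fin n)) (f := fun b i => ∑ j, _)]
    refine Finset.sum_congr rfl fun i _ => ?_
    rw [Finset.sum_comm]
    refine Finset.sum_congr rfl fun j _ => ?_
    rw [Matrix.mulVec, dotProduct, Finset.mul_sum]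
    exact Finset.sum_congr rfl fun b _ => by ring
  rw [bilin_transpose_mul_self, hc]
  simp only [dotProduct, Finset.sum_mul]
  exact Finset.sum_congr rfl fun a _ => Finset.sum_congr rfl fun b _ => by ring

end

section

variable {n : ℕ}

/-! ### Calculus of one-forms -/

/-- `f` is differentiable at `p` with `df = v`. -/
def HasGrad (f : (Fin n → ℝ) → ℝ) (v : Fin n → ℝ) (p : Fin n → ℝ) : Prop :=
  DifferentiableAt ℝ f p ∧ ∀ i, pd i f p = v i

/-- The one-form `α` is differentiable at `p` with exterior derivative `dα = w`, where
`wᵢⱼ = dα(∂ᵢ, ∂ⱼ) = ∂ᵢ αⱼ - ∂ⱼ αᵢ`. -/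
def HasExtd (α : (Fin n → ℝ) → Fin n → ℝ) (w : Matrix (Fin n) (Fin n) ℝ) (p : Fin n → ℝ) : Prop :=
  (∀ j, DifferentiableAt ℝ (fun q => α q j) p) ∧
    ∀ i j, pd i (fun q => α q j) p - pd j (fun q => α q i) p = w i j

variable {p : Fin n → ℝ} {f f' : (Fin n → ℝ) → ℝ} {v v' : Fin n → ℝ}
  {α β : (Fin n → ℝ) → Fin n → ℝ} {w w' : Matrix (Fin n) (Fin n) ℝ}

theorem HasGrad.mul (hf : HasGrad f v p) (hf' : HasGrad f' v' p) :
    HasGrad (fun q => f q * f' q) (f' p • v + f p • v') p := by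
  refine ⟨hf.1.fun_mul hf'.1, fun i => ?_⟩
  rw [pd_mul hf.1 hf'.1, hf.2, hf'.2]
  simp [mul_comm]

theorem hasGrad_const (c : ℝ) (p : Fin n → ℝ) : HasGrad (fun _ => c) 0 p :=
  ⟨by fun_prop, fun i => by simp [pd_const]⟩

theorem HasGrad.neg (hf : HasGrad f v p) : HasGrad (fun q => -f q) (-v) p := by
  refine ⟨hf.1.fun_neg, fun i => ?_⟩
  rw [pd, fderiv_fun_neg]
  exact congrArg Neg.neg (hf.2 i)

/-- Chain rule for a function of a single coordinate. -/
theorem hasGrad_comp_coord {k : ℝ → ℝ} {k' : ℝ} {a : Fin n} (hk : HasDerivAt k k' (p a)) :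
    HasGrad (fun q => k (q a)) (Pi.single a k') p := by
  have hp : HasFDerivAt (fun q : Fin n → ℝ => q a) (ContinuousLinearMap.proj (R := ℝ) a) p :=
    hasFDerivAt_apply a p
  have := hk.comp_hasFDerivAt p hp
  refine ⟨this.differentiableAt, fun i => ?_⟩
  have e : pd i (k ∘ fun q => q a) p = Pi.single (M := fun _ => ℝ) a k' i := by
    rw [pd, this.fderiv]
    by_cases hi : i = a
    · subst hi; simp
    · simp [hi, Ne.symm hi]
  exact e

theorem hasExtd_const (c : Fin n → ℝ) (p : Fin n → ℝ) : HasExtd (fun _ => c) 0 p :=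
  ⟨by fun_prop, fun i j => by simp [pd_const]⟩

theorem HasExtd.congr (hα : HasExtd α w p) (h : w = w') : HasExtd α w' p :=
  h ▸ hα

theorem HasExtd.add (hα : HasExtd α w p) (hβ : HasExtd β w' p) :
    HasExtd (fun q => α q + β q) (w + w') p := by
  refine ⟨fun j => (hα.1 j).fun_add (hβ.1 j), fun i j => ?_⟩
  simp only [Pi.add_apply, Matrix.add_apply, ← hα.2, ← hβ.2]
  rw [pd_add (hα.1 j) (hβ.1 j), pd_add (hα.1 i) (hβ.1 i)]
  ring

theorem HasExtd.smul (hf : HasGrad f v p) (hα : HasExtd α w p) :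
    HasExtd (fun q => f q • α q) (wedge v (α p) + f p • w) p := by
  refine ⟨fun j => hf.1.fun_mul (hα.1 j), fun i j => ?_⟩
  simp only [Pi.smul_apply, smul_eq_mul, Matrix.add_apply, Matrix.smul_apply, ← hα.2, wedge,
    Matrix.sub_apply, Matrix.vecMulVec_apply]
  rw [pd_mul hf.1 (hα.1 j), pd_mul hf.1 (hα.1 i), hf.2, hf.2]
  ring

theorem HasExtd.neg (hα : HasExtd α w p) : HasExtd (fun q => -α q) (-w) p := by
  have := HasExtd.smul (hasGrad_const (-1) p) hα
  have e : wedge 0 (α p) + (-1 : ℝ) • w = -w := by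
    ext i j
    simp [wedge]
  rw [e] at this
  simpa using this

theorem HasExtd.sub (hα : HasExtd α w p) (hβ : HasExtd β w' p) :
    HasExtd (fun q => α q - β q) (w - w') p := by
  simpa only [sub_eq_add_neg] using hα.add hβ.neg

/-- `d(f c) = df ∧ c` for a constant covector `c`. -/
theorem HasGrad.smul_const (hf : HasGrad f v p) (c : Fin n → ℝ) :
    HasExtd (fun q => f q • c) (wedge v c) p := by
  simpa using HasExtd.smul hf (hasExtd_const c p)

theorem wedge_apply (a b : Fin n → ℝ) (i j : Fin n) : wedge a b i j = a i * b j - b i * a j := by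
  simp [wedge, Matrix.vecMulVec_apply]

/-! ### Smoothness of inverse matrices -/

section

variable {M : Set (Fin n → ℝ)} {A : (Fin n → ℝ) → Matrix (Fin n) (Fin n) ℝ}

theorem SmoothOn.det (hA : SmoothOn M A) : ContDiffOn ℝ ∞ (fun p => (A p).det) M := by
  simp only [Matrix.det_apply]
  exact ContDiffOn.sum fun σ _ => (contDiffOn_prod fun i _ => hA _ _).const_smul _

theorem SmoothOn.inv (hA : SmoothOn M A) (hdet : ∀ p ∈ M, (A p).det ≠ 0) :
    SmoothOn M fun p => (A p)⁻¹ := by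
  intro i j
  simp only [Matrix.inv_def, Ring.inverse_eq_inv', Matrix.smul_apply, smul_eq_mul,
    Matrix.adjugate_apply]
  refine (hA.det.inv hdet).mul (SmoothOn.det fun a b => ?_)
  by_cases ha : a = j
  · subst ha
    simp only [Matrix.updateRow_self]
    exact contDiffOn_const
  · simp only [Matrix.updateRow_ne ha]
    exact hA a b

end

/-! ### The total space -/

theorem hasFDerivAt_base (p : Fin 4 → ℝ) : HasFDerivAt base
    (ContinuousLinearMap.pi ![ContinuousLinearMap.proj (R := ℝ) (φ := fun _ : Fin 4 => ℝ) 0,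
      ContinuousLinearMap.proj 1]) p := by
  rw [hasFDerivAt_pi']
  intro i
  fin_cases i
  · exact hasFDerivAt_apply (0 : Fin 4) p
  · exact hasFDerivAt_apply (1 : Fin 4) p

theorem contDiff_base : ContDiff ℝ ∞ base := by
  rw [contDiff_pi]
  intro i
  fin_cases i
  · exact contDiff_apply ℝ ℝ (0 : Fin 4)
  · exact contDiff_apply ℝ ℝ (1 : Fin 4)

theorem isOpen_total {U : Set (Fin 2 → ℝ)} (hU : IsOpen U) : IsOpen (total U) :=
  (hU.preimage contDiff_base.continuous).inter (isOpen_lt (continuous_apply 2) continuous_const)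

/-- The differential of a function pulled back from the base. -/
theorem hasGrad_comp_base {f : (Fin 2 → ℝ) → ℝ} {p : Fin 4 → ℝ}
    (hf : DifferentiableAt ℝ f (base p)) :
    HasGrad (fun q => f (base q))
      (pd 0 f (base p) • dcoord 0 + pd 1 f (base p) • dcoord 1) p := by
  have := hf.hasFDerivAt.comp p (hasFDerivAt_base p)
  refine ⟨this.differentiableAt, fun i => ?_⟩
  have e : pd i (f ∘ base) p = (pd 0 f (base p) • dcoord 0 + pd 1 f (base p) • dcoord 1) i := by
    rw [pd, this.fderiv, ContinuousLinearMap.comp_apply]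
    have hv : (ContinuousLinearMap.pi ![ContinuousLinearMap.proj (R := ℝ)
        (φ := fun _ : Fin 4 => ℝ) 0, ContinuousLinearMap.proj 1]) (Pi.single i 1)
        = dcoord 0 i • Pi.single (M := fun _ : Fin 2 => ℝ) 0 (1 : ℝ)
          + dcoord 1 i • Pi.single (M := fun _ : Fin 2 => ℝ) 1 (1 : ℝ) := by
      ext k
      fin_cases k <;> fin_cases i <;> simp [dcoord]
    rw [hv, map_add, map_smul, map_smul]
    simp [pd, mul_comm]
  exact e

/-- The data `(U, h, H)`: positive smooth functions on an open set with
`Δ ln H = ½ h² + H²`. -/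
structure IsData (U : Set (Fin 2 → ℝ)) (h H : (Fin 2 → ℝ) → ℝ) : Prop where
  isOpen : IsOpen U
  smooth_h : ContDiffOn ℝ ∞ h U
  pos_h : ∀ q ∈ U, 0 < h q
  smooth_H : ContDiffOn ℝ ∞ H U
  pos_H : ∀ q ∈ U, 0 < H q
  eq : ∀ q ∈ U, lap (fun q => Real.log (H q)) q = (1 / 2) * h q ^ 2 + H q ^ 2

/-- The logarithmic derivative `∂(ln f)/∂xⁱ`. -/
noncomputable def dlog (i : Fin 2) (f : (Fin 2 → ℝ) → ℝ) : (Fin 2 → ℝ) → ℝ :=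
  pd i fun q => Real.log (f q)

theorem contDiffOn_dlog {U : Set (Fin 2 → ℝ)} (hU : IsOpen U) {f : (Fin 2 → ℝ) → ℝ}
    (hf : ContDiffOn ℝ ∞ f U) (hpos : ∀ q ∈ U, 0 < f q) (i : Fin 2) :
    ContDiffOn ℝ ∞ (dlog i f) U :=
  contDiffOn_pd hU (hf.log fun q hq => (hpos q hq).ne') i

theorem pd_eq_mul_dlog {U : Set (Fin 2 → ℝ)} (hU : IsOpen U) {f : (Fin 2 → ℝ) → ℝ}
    (hf : ContDiffOn ℝ ∞ f U) (hpos : ∀ q ∈ U, 0 < f q) (i : Fin 2) {q : Fin 2 → ℝ} (hq : q ∈ U) :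
    pd i f q = f q * dlog i f q := by
  have hd : DifferentiableAt ℝ f q := (hf.contDiffAt (hU.mem_nhds hq)).differentiableAt (by simp)
  have hne := (hpos q hq).ne'
  rw [dlog, pd, pd, fderiv.log hd hne]
  simp [hne]

variable {U : Set (Fin 2 → ℝ)} {h H : (Fin 2 → ℝ) → ℝ}

theorem hasGrad_pos {f : (Fin 2 → ℝ) → ℝ} (hU : IsOpen U) (hf : ContDiffOn ℝ ∞ f U)
    (hpos : ∀ q ∈ U, 0 < f q) {p : Fin 4 → ℝ} (hp : p ∈ total U) :
    HasGrad (fun q => f (base q)) (f (base p) •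
      (dlog 0 f (base p) • dcoord 0 + dlog 1 f (base p) • dcoord 1)) p := by
  have := hasGrad_comp_base ((hf.contDiffAt (hU.mem_nhds hp.1)).differentiableAt (by simp))
  rw [pd_eq_mul_dlog hU hf hpos 0 hp.1, pd_eq_mul_dlog hU hf hpos 1 hp.1] at this
  rwa [smul_add, smul_smul, smul_smul]

/-! ### The coframe and its connection forms -/

/-- `a = H (cos t dx + sin t dy)`, so that `θ₄ = dz - a`. -/
noncomputable def formA (H : (Fin 2 → ℝ) → ℝ) (p : Fin 4 → ℝ) : Fin 4 → ℝ :=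
  (Real.cos (p 3) * H (base p)) • dcoord 0 + (Real.sin (p 3) * H (base p)) • dcoord 1

/-- `b = H (-sin t dx + cos t dy)`. -/
noncomputable def formB (H : (Fin 2 → ℝ) → ℝ) (p : Fin 4 → ℝ) : Fin 4 → ℝ :=
  (-Real.sin (p 3) * H (base p)) • dcoord 0 + (Real.cos (p 3) * H (base p)) • dcoord 1

/-- `φ = dt - l₂ dx - n₂ dy`. -/
noncomputable def formPhi (H : (Fin 2 → ℝ) → ℝ) (p : Fin 4 → ℝ) : Fin 4 → ℝ :=
  dcoord 3 - l₂ H (base p) • dcoord 0 - n₂ H (base p) • dcoord 1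

/-- `β = (ln h)_y dx - (ln h)_x dy`, the Levi-Civita connection form of `h² (dx² + dy²)`. Applied to
`H`, it is `l₂ dx + n₂ dy`. -/
noncomputable def formBase (h : (Fin 2 → ℝ) → ℝ) (p : Fin 4 → ℝ) : Fin 4 → ℝ :=
  dlog 1 h (base p) • dcoord 0 - dlog 0 h (base p) • dcoord 1

/-- The connection form `ω₃₄ = cosh z φ - sinh z b`. -/
noncomputable def connVert (H : (Fin 2 → ℝ) → ℝ) (p : Fin 4 → ℝ) : Fin 4 → ℝ :=
  Real.cosh (p 2) • formPhi H p - Real.sinh (p 2) • formB H p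

/-- The connection form `ω₁₂ = β - ½ φ - ½ ω₃₄`. -/
noncomputable def connHor (h H : (Fin 2 → ℝ) → ℝ) (p : Fin 4 → ℝ) : Fin 4 → ℝ :=
  formBase h p - (1 / 2 : ℝ) • formPhi H p - (1 / 2 : ℝ) • connVert H p

/-- The connection forms `ω₁₄ = ω₂₃ = ½ cosh (z/2) h dx` (for `i = 0`) and
`ω₂₄ = -ω₁₃ = ½ cosh (z/2) h dy` (for `i = 1`). -/
noncomputable def connMixed (h : (Fin 2 → ℝ) → ℝ) (i : Fin 4) (p : Fin 4 → ℝ) : Fin 4 → ℝ :=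
  (1 / 2 * Real.cosh (p 2 / 2) * h (base p)) • dcoord i

/-- The covectors `sinh (z/2) h dx` and `sinh (z/2) h dy`. -/
noncomputable def horForm (h : (Fin 2 → ℝ) → ℝ) (i : Fin 4) (p : Fin 4 → ℝ) : Fin 4 → ℝ :=
  (Real.sinh (p 2 / 2) * h (base p)) • dcoord i

theorem theta₄_eq (H : (Fin 2 → ℝ) → ℝ) (p : Fin 4 → ℝ) : θ₄ H p = dcoord 2 - formA H p := by
  rw [θ₄, formA, sub_sub]

theorem theta₃_eq (H : (Fin 2 → ℝ) → ℝ) (p : Fin 4 → ℝ) :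
    θ₃ H p = Real.sinh (p 2) • formPhi H p - Real.cosh (p 2) • formB H p := by
  ext i
  simp only [θ₃, formPhi, formB, Pi.sub_apply, Pi.add_apply, Pi.smul_apply, smul_eq_mul]
  ring

variable {p : Fin 4 → ℝ}

theorem hasGrad_comp_dcoord {k : ℝ → ℝ} {k' : ℝ} {a : Fin 4} (hk : HasDerivAt k k' (p a)) :
    HasGrad (fun q => k (q a)) (k' • dcoord a) p := by
  have : k' • dcoord a = Pi.single a k' := by
    ext i; simp [dcoord, Pi.single_apply]
  rw [this]
  exact hasGrad_comp_coord hk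

theorem hasGrad_sinh_half : HasGrad (fun q : Fin 4 → ℝ => Real.sinh (q 2 / 2))
    ((1 / 2 * Real.cosh (p 2 / 2)) • dcoord 2) p := by
  refine hasGrad_comp_dcoord (k := fun z => Real.sinh (z / 2)) ?_
  exact (((hasDerivAt_id' (p 2)).div_const 2).sinh).congr_deriv (by ring)

theorem hasGrad_cosh_half : HasGrad (fun q : Fin 4 → ℝ => Real.cosh (q 2 / 2))
    ((1 / 2 * Real.sinh (p 2 / 2)) • dcoord 2) p := by
  refine hasGrad_comp_dcoord (k := fun z => Real.cosh (z / 2)) ?_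
  exact (((hasDerivAt_id' (p 2)).div_const 2).cosh).congr_deriv (by ring)

/-- `da = φ ∧ b`: the terms `l₂ dx + n₂ dy` in `φ` absorb the derivatives of `H`. -/
theorem extd_formA (hd : IsData U h H) (hp : p ∈ total U) :
    HasExtd (formA H) (wedge (formPhi H p) (formB H p)) p := by
  have hH := hasGrad_pos hd.isOpen hd.smooth_H hd.pos_H hp
  have h1 := ((hasGrad_comp_dcoord (Real.hasDerivAt_cos (p 3))).mul hH).smul_const (dcoord 0)
  have h2 := ((hasGrad_comp_dcoord (Real.hasDerivAt_sin (p 3))).mul hH).smul_const (dcoord 1)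
  refine HasExtd.congr (h1.add h2) ?_
  ext i j
  simp only [wedge_apply, formPhi, formB, Matrix.add_apply, Pi.add_apply, Pi.sub_apply,
    Pi.smul_apply, smul_eq_mul, l₂, n₂, dlog]
  ring

theorem extd_formB (hd : IsData U h H) (hp : p ∈ total U) :
    HasExtd (formB H) (-wedge (formPhi H p) (formA H p)) p := by
  have hH := hasGrad_pos hd.isOpen hd.smooth_H hd.pos_H hp
  have h1 := ((hasGrad_comp_dcoord (Real.hasDerivAt_sin (p 3))).neg.mul hH).smul_const (dcoord 0)
  have h2 := ((hasGrad_comp_dcoord (Real.hasDerivAt_cos (p 3))).mul hH).smul_const (dcoord 1)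
  refine HasExtd.congr (h1.add h2) ?_
  ext i j
  simp only [wedge_apply, formPhi, formA, Matrix.add_apply, Matrix.neg_apply, Pi.add_apply,
    Pi.sub_apply, Pi.neg_apply, Pi.smul_apply, smul_eq_mul, l₂, n₂, dlog]
  ring

theorem hasGrad_dlog {f : (Fin 2 → ℝ) → ℝ} (hU : IsOpen U) (hf : ContDiffOn ℝ ∞ f U)
    (hpos : ∀ q ∈ U, 0 < f q) (hp : p ∈ total U) (i : Fin 2) :
    HasGrad (fun q => dlog i f (base q)) (pd 0 (dlog i f) (base p) • dcoord 0
      + pd 1 (dlog i f) (base p) • dcoord 1) p :=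
  hasGrad_comp_base (((contDiffOn_dlog hU hf hpos i).contDiffAt
    (hU.mem_nhds hp.1)).differentiableAt (by simp))

/-- `dβ = -Δ(ln f) dx ∧ dy`, the Gauss curvature form of `f² (dx² + dy²)`. -/
theorem extd_formBase {f : (Fin 2 → ℝ) → ℝ} (hU : IsOpen U) (hf : ContDiffOn ℝ ∞ f U)
    (hpos : ∀ q ∈ U, 0 < f q) (hp : p ∈ total U) :
    HasExtd (formBase f)
      (-lap (fun q => Real.log (f q)) (base p) • wedge (dcoord 0) (dcoord 1)) p := by
  have h1 := (hasGrad_dlog hU hf hpos hp 1).smul_const (dcoord 0)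
  have h2 := (hasGrad_dlog hU hf hpos hp 0).smul_const (dcoord 1)
  refine HasExtd.congr (h1.sub h2) ?_
  ext i j
  simp only [wedge_apply, Matrix.sub_apply, Matrix.smul_apply, Pi.add_apply, Pi.smul_apply,
    smul_eq_mul, lap, dlog]
  ring

theorem formPhi_eq (H : (Fin 2 → ℝ) → ℝ) (p : Fin 4 → ℝ) :
    formPhi H p = dcoord 3 - formBase H p := by
  simp only [formPhi, formBase, l₂, n₂, dlog]
  module

/-- The differential equation for `H` in the form `dφ = (½ h² + H²) dx ∧ dy`. -/
theorem extd_formPhi (hd : IsData U h H) (hp : p ∈ total U) :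
    HasExtd (formPhi H) ((1 / 2 * h (base p) ^ 2 + H (base p) ^ 2)
      • wedge (dcoord 0) (dcoord 1)) p := by
  have h1 := (hasExtd_const (dcoord 3) p).sub
    (extd_formBase hd.isOpen hd.smooth_H hd.pos_H hp)
  rw [funext (formPhi_eq H)]
  refine HasExtd.congr (h1) ?_
  rw [hd.eq _ hp.1, neg_smul, zero_sub, neg_neg]

theorem formA_wedge_formB (H : (Fin 2 → ℝ) → ℝ) (p : Fin 4 → ℝ) :
    wedge (formA H p) (formB H p) = H (base p) ^ 2 • wedge (dcoord 0) (dcoord 1) := by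
  ext i j
  simp only [wedge_apply, formA, formB, Matrix.smul_apply, Pi.add_apply, Pi.smul_apply,
    smul_eq_mul]
  linear_combination (H (base p) ^ 2 * (dcoord 0 i * dcoord 1 j - dcoord 1 i * dcoord 0 j))
    * Real.cos_sq_add_sin_sq (p 3)

theorem sinh_eq (z : ℝ) : Real.sinh z = 2 * Real.sinh (z / 2) * Real.cosh (z / 2) := by
  rw [← Real.sinh_two_mul]; ring_nf

theorem cosh_eq (z : ℝ) : Real.cosh z = 2 * Real.sinh (z / 2) ^ 2 + 1 := by
  have := Real.cosh_two_mul (z / 2)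
  rw [mul_div_cancel₀ z two_ne_zero] at this
  rw [this, Real.cosh_sq]; ring

/-- The curvature form `Ω₃₄ = dω₃₄ - 2 ω₁₄ ∧ ω₂₄` is `½ e₁ ∧ e₂ - e₃ ∧ e₄`. -/
theorem extd_connVert (hd : IsData U h H) (hp : p ∈ total U) :
    HasExtd (connVert H) ((1 / 2 : ℝ) • wedge (horForm h 0 p) (horForm h 1 p)
      - wedge (θ₃ H p) (θ₄ H p) + (2 : ℝ) • wedge (connMixed h 0 p) (connMixed h 1 p)) p := by
  have h1 := HasExtd.smul (hasGrad_comp_dcoord (Real.hasDerivAt_cosh (p 2))) (extd_formPhi hd hp)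
  have h2 := HasExtd.smul (hasGrad_comp_dcoord (Real.hasDerivAt_sinh (p 2))) (extd_formB hd hp)
  refine HasExtd.congr (h1.sub h2) ?_
  ext i j
  have hab := congrFun (congrFun (formA_wedge_formB H p) i) j
  simp only [wedge_apply, theta₃_eq, theta₄_eq, horForm, connMixed, Matrix.sub_apply,
    Matrix.add_apply, Matrix.neg_apply, Matrix.smul_apply, Pi.sub_apply, Pi.smul_apply,
    smul_eq_mul] at hab ⊢
  linear_combination -(Real.cosh (p 2)) * hab + 1 / 2 * h (base p) ^ 2 *
    (dcoord 0 i * dcoord 1 j - dcoord 1 i * dcoord 0 j)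
      * (cosh_eq (p 2) - Real.cosh_sq (p 2 / 2))

/-- First structure equation `de₄ = ω₁₄ ∧ e₁ + ω₂₄ ∧ e₂ + ω₃₄ ∧ e₃`; the first two terms are zero
because `ω₁₄` and `ω₂₄` are proportional to `e₁` and `e₂`. -/
theorem extd_theta₄ (hd : IsData U h H) (hp : p ∈ total U) :
    HasExtd (θ₄ H) (wedge (connMixed h 0 p) (horForm h 0 p)
      + wedge (connMixed h 1 p) (horForm h 1 p) + wedge (connVert H p) (θ₃ H p)) p := by
  have h1 := (hasExtd_const (dcoord 2) p).sub (extd_formA hd hp)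
  rw [funext (theta₄_eq H)]
  refine HasExtd.congr (h1) ?_
  ext i j
  simp only [wedge_apply, theta₃_eq, connMixed, connVert, horForm, Matrix.sub_apply,
    Matrix.add_apply, Matrix.zero_apply, Pi.sub_apply, Pi.smul_apply, smul_eq_mul]
  linear_combination (formPhi H p i * formB H p j - formB H p i * formPhi H p j) *
    Real.cosh_sq_sub_sinh_sq (p 2)

/-- First structure equation `de₃ = -ω₂₄ ∧ e₁ + ω₁₄ ∧ e₂ - ω₃₄ ∧ e₄`. -/
theorem extd_theta₃ (hd : IsData U h H) (hp : p ∈ total U) :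
    HasExtd (θ₃ H) (-wedge (connMixed h 1 p) (horForm h 0 p)
      + wedge (connMixed h 0 p) (horForm h 1 p) - wedge (connVert H p) (θ₄ H p)) p := by
  have h1 := HasExtd.smul (hasGrad_comp_dcoord (Real.hasDerivAt_sinh (p 2))) (extd_formPhi hd hp)
  have h2 := HasExtd.smul (hasGrad_comp_dcoord (Real.hasDerivAt_cosh (p 2))) (extd_formB hd hp)
  rw [funext (theta₃_eq H)]
  refine HasExtd.congr (h1.sub h2) ?_
  ext i j
  have hab := congrFun (congrFun (formA_wedge_formB H p) i) j
  simp only [wedge_apply, theta₄_eq, connMixed, connVert, horForm, Matrix.sub_apply,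
    Matrix.add_apply, Matrix.neg_apply, Matrix.smul_apply, Pi.sub_apply, Pi.smul_apply,
    smul_eq_mul] at hab ⊢
  linear_combination -(Real.sinh (p 2)) * hab + (1 / 2 * h (base p) ^ 2 *
    (dcoord 0 i * dcoord 1 j - dcoord 1 i * dcoord 0 j)) * sinh_eq (p 2)

/-- First structure equation `de₁ = -ω₁₂ ∧ e₂ + ω₂₄ ∧ e₃ - ω₁₄ ∧ e₄`. -/
theorem extd_horForm₀ (hd : IsData U h H) (hp : p ∈ total U) :
    HasExtd (horForm h 0) (-wedge (connHor h H p) (horForm h 1 p)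
      + wedge (connMixed h 1 p) (θ₃ H p) - wedge (connMixed h 0 p) (θ₄ H p)) p := by
  have h1 := (hasGrad_sinh_half.mul (hasGrad_pos hd.isOpen hd.smooth_h hd.pos_h hp)).smul_const
    (dcoord 0)
  refine HasExtd.congr (h1) ?_
  ext i j
  simp only [wedge_apply, theta₃_eq, theta₄_eq, connMixed, connHor, connVert, formBase, horForm,
    Matrix.sub_apply, Matrix.add_apply, Matrix.neg_apply, Pi.sub_apply,
    Pi.add_apply, Pi.smul_apply, smul_eq_mul, sinh_eq (p 2), cosh_eq (p 2), formA, formB]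
  have hC := Real.cosh_sq (p 2 / 2)
  grind

/-- First structure equation `de₂ = ω₁₂ ∧ e₁ - ω₁₄ ∧ e₃ - ω₂₄ ∧ e₄`. -/
theorem extd_horForm₁ (hd : IsData U h H) (hp : p ∈ total U) :
    HasExtd (horForm h 1) (wedge (connHor h H p) (horForm h 0 p)
      - wedge (connMixed h 0 p) (θ₃ H p) - wedge (connMixed h 1 p) (θ₄ H p)) p := by
  have h1 := (hasGrad_sinh_half.mul (hasGrad_pos hd.isOpen hd.smooth_h hd.pos_h hp)).smul_const
    (dcoord 1)
  refine HasExtd.congr (h1) ?_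
  ext i j
  simp only [wedge_apply, theta₃_eq, theta₄_eq, connMixed, connHor, connVert, formBase, horForm,
    Matrix.sub_apply, Pi.sub_apply,
    Pi.add_apply, Pi.smul_apply, smul_eq_mul, sinh_eq (p 2), cosh_eq (p 2), formA, formB]
  have hC := Real.cosh_sq (p 2 / 2)
  grind

/-- Second structure equation for `ω₁₄`: the curvature form is `-¼ (e₁ ∧ e₄ + e₂ ∧ e₃)`. -/
theorem extd_connMixed₀ (hd : IsData U h H) (hp : p ∈ total U) :
    HasExtd (connMixed h 0) (-(1 / 4 : ℝ) • (wedge (horForm h 0 p) (θ₄ H p)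
        + wedge (horForm h 1 p) (θ₃ H p))
      - wedge (connHor h H p) (connMixed h 1 p) + wedge (connMixed h 1 p) (connVert H p)) p := by
  have h1 := (((hasGrad_const (1 / 2) p).mul hasGrad_cosh_half).mul
    (hasGrad_pos hd.isOpen hd.smooth_h hd.pos_h hp)).smul_const (dcoord 0)
  refine HasExtd.congr (h1) ?_
  ext i j
  simp only [wedge_apply, theta₃_eq, theta₄_eq, connMixed, connHor, connVert, formBase, horForm,
    Matrix.sub_apply, Matrix.add_apply, Matrix.smul_apply, Pi.sub_apply,
    Pi.add_apply, Pi.smul_apply, smul_eq_mul, sinh_eq (p 2), cosh_eq (p 2), formA, formB,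
    Pi.zero_apply]
  have hC := Real.cosh_sq (p 2 / 2)
  grind

/-- Second structure equation for `ω₂₄`: the curvature form is `¼ (e₁ ∧ e₃ - e₂ ∧ e₄)`. -/
theorem extd_connMixed₁ (hd : IsData U h H) (hp : p ∈ total U) :
    HasExtd (connMixed h 1) ((1 / 4 : ℝ) • (wedge (horForm h 0 p) (θ₃ H p)
        - wedge (horForm h 1 p) (θ₄ H p))
      + wedge (connHor h H p) (connMixed h 0 p) - wedge (connMixed h 0 p) (connVert H p)) p := by
  have h1 := (((hasGrad_const (1 / 2) p).mul hasGrad_cosh_half).mul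
    (hasGrad_pos hd.isOpen hd.smooth_h hd.pos_h hp)).smul_const (dcoord 1)
  refine HasExtd.congr (h1) ?_
  ext i j
  simp only [wedge_apply, theta₃_eq, theta₄_eq, connMixed, connHor, connVert, formBase, horForm,
    Matrix.sub_apply, Matrix.add_apply, Matrix.smul_apply, Pi.sub_apply,
    Pi.add_apply, Pi.smul_apply, smul_eq_mul, sinh_eq (p 2), cosh_eq (p 2), formA, formB,
    Pi.zero_apply]
  have hC := Real.cosh_sq (p 2 / 2)
  grind

end

section

variable {U : Set (Fin 2 → ℝ)} {h H : (Fin 2 → ℝ) → ℝ} {p : Fin 4 → ℝ}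

/-! ### The moving frame of the metric -/

/-- The orthonormal coframe `sinh (z/2) h dx, sinh (z/2) h dy, θ₃, θ₄` of `metric h H`. -/
noncomputable def coframe (h H : (Fin 2 → ℝ) → ℝ) (p : Fin 4 → ℝ) : Matrix (Fin 4) (Fin 4) ℝ :=
  Matrix.of ![horForm h 0 p, horForm h 1 p, θ₃ H p, θ₄ H p]

/-- The Levi-Civita connection forms of `coframe h H`. -/
noncomputable def connForm (h H : (Fin 2 → ℝ) → ℝ) (i : Fin 4) (p : Fin 4 → ℝ) :
    Matrix (Fin 4) (Fin 4) ℝ :=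
  !![0, connHor h H p i, -connMixed h 1 p i, connMixed h 0 p i;
    -connHor h H p i, 0, connMixed h 0 p i, connMixed h 1 p i;
    connMixed h 1 p i, -connMixed h 0 p i, 0, connVert H p i;
    -connMixed h 0 p i, -connMixed h 1 p i, -connVert H p i, 0]

theorem metric_eq (h H : (Fin 2 → ℝ) → ℝ) :
    metric h H = fun q => (coframe h H q)ᵀ * coframe h H q := by
  funext q
  ext i j
  simp only [metric, metricBase, coframe, horForm, Matrix.mul_apply, Fin.sum_univ_four,
    Matrix.add_apply, Matrix.smul_apply, Matrix.vecMulVec_apply, Matrix.transpose_apply,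
    Matrix.of_apply, Matrix.cons_val, Pi.smul_apply, smul_eq_mul]
  ring

theorem sinh_half_neg (hp : p ∈ total U) : Real.sinh (p 2 / 2) < 0 := by
  rw [Real.sinh_neg_iff]
  exact div_neg_of_neg_of_pos hp.2 two_pos

theorem det_coframe_ne_zero (hd : IsData U h H) (hp : p ∈ total U) : (coframe h H p).det ≠ 0 := by
  have h1 : (coframe h H p).det
      = -((Real.sinh (p 2 / 2) * h (base p)) ^ 2 * Real.sinh (p 2)) := by
    simp [coframe, horForm, θ₃, θ₄, dcoord, Matrix.det_succ_row_zero, Fin.sum_univ_succ,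
      Fin.succAbove]
    ring
  have h2 := (sinh_half_neg hp).ne
  have h3 := (hd.pos_h _ hp.1).ne'
  have h4 : Real.sinh (p 2) ≠ 0 := (Real.sinh_neg_iff.2 hp.2).ne
  rw [h1]
  exact neg_ne_zero.2 (mul_ne_zero (pow_ne_zero 2 (mul_ne_zero h2 h3)) h4)

theorem contDiffOn_comp_base {f : (Fin 2 → ℝ) → ℝ} (hf : ContDiffOn ℝ ∞ f U) :
    ContDiffOn ℝ ∞ (fun q => f (base q)) (total U) :=
  hf.comp contDiff_base.contDiffOn fun _ hq => hq.1

theorem contDiff_half (a : Fin 4) : ContDiff ℝ ∞ fun q : Fin 4 → ℝ => q a / 2 :=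
  (contDiff_apply ℝ ℝ a).div_const 2

theorem contDiffOn_horForm (hd : IsData U h H) (i : Fin 4) :
    ContDiffOn ℝ ∞ (horForm h i) (total U) :=
  ((contDiff_half 2).sinh.contDiffOn.mul (contDiffOn_comp_base hd.smooth_h)).smul contDiffOn_const

theorem contDiffOn_connMixed (hd : IsData U h H) (i : Fin 4) :
    ContDiffOn ℝ ∞ (connMixed h i) (total U) :=
  ((contDiffOn_const.mul (contDiff_half 2).cosh.contDiffOn).mul
    (contDiffOn_comp_base hd.smooth_h)).smul contDiffOn_const

theorem contDiffOn_formA (hd : IsData U h H) : ContDiffOn ℝ ∞ (formA H) (total U) :=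
  (((contDiff_apply ℝ ℝ 3).cos.contDiffOn.mul (contDiffOn_comp_base hd.smooth_H)).smul
    contDiffOn_const).add
  (((contDiff_apply ℝ ℝ 3).sin.contDiffOn.mul (contDiffOn_comp_base hd.smooth_H)).smul
    contDiffOn_const)

theorem contDiffOn_formB (hd : IsData U h H) : ContDiffOn ℝ ∞ (formB H) (total U) :=
  (((contDiff_apply ℝ ℝ 3).sin.neg.contDiffOn.mul (contDiffOn_comp_base hd.smooth_H)).smul
    contDiffOn_const).add
  (((contDiff_apply ℝ ℝ 3).cos.contDiffOn.mul (contDiffOn_comp_base hd.smooth_H)).smul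
    contDiffOn_const)

theorem contDiffOn_formBase {f : (Fin 2 → ℝ) → ℝ} (hU : IsOpen U) (hf : ContDiffOn ℝ ∞ f U)
    (hpos : ∀ q ∈ U, 0 < f q) : ContDiffOn ℝ ∞ (formBase f) (total U) :=
  ((contDiffOn_comp_base (contDiffOn_dlog hU hf hpos 1)).smul contDiffOn_const).sub
    ((contDiffOn_comp_base (contDiffOn_dlog hU hf hpos 0)).smul contDiffOn_const)

theorem contDiffOn_formPhi (hd : IsData U h H) : ContDiffOn ℝ ∞ (formPhi H) (total U) := by
  rw [funext (formPhi_eq H)]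
  exact contDiffOn_const.sub (contDiffOn_formBase hd.isOpen hd.smooth_H hd.pos_H)

theorem contDiffOn_connVert (hd : IsData U h H) : ContDiffOn ℝ ∞ (connVert H) (total U) :=
  ((contDiff_apply ℝ ℝ 2).cosh.contDiffOn.smul (contDiffOn_formPhi hd)).sub
    ((contDiff_apply ℝ ℝ 2).sinh.contDiffOn.smul (contDiffOn_formB hd))

theorem contDiffOn_connHor (hd : IsData U h H) : ContDiffOn ℝ ∞ (connHor h H) (total U) :=
  ((contDiffOn_formBase hd.isOpen hd.smooth_h hd.pos_h).sub
    ((contDiffOn_const (c := (1 / 2 : ℝ))).smul (contDiffOn_formPhi hd))).sub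
    ((contDiffOn_const (c := (1 / 2 : ℝ))).smul (contDiffOn_connVert hd))

theorem contDiffOn_theta₃ (hd : IsData U h H) : ContDiffOn ℝ ∞ (θ₃ H) (total U) := by
  rw [funext (theta₃_eq H)]
  exact ((contDiff_apply ℝ ℝ 2).sinh.contDiffOn.smul (contDiffOn_formPhi hd)).sub
    ((contDiff_apply ℝ ℝ 2).cosh.contDiffOn.smul (contDiffOn_formB hd))

theorem contDiffOn_theta₄ (hd : IsData U h H) : ContDiffOn ℝ ∞ (θ₄ H) (total U) := by
  rw [funext (theta₄_eq H)]
  exact contDiffOn_const.sub (contDiffOn_formA hd)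

theorem smoothOn_coframe (hd : IsData U h H) : SmoothOn (total U) (coframe h H) := by
  intro i j
  fin_cases i
  · exact contDiffOn_pi.1 (contDiffOn_horForm hd 0) j
  · exact contDiffOn_pi.1 (contDiffOn_horForm hd 1) j
  · exact contDiffOn_pi.1 (contDiffOn_theta₃ hd) j
  · exact contDiffOn_pi.1 (contDiffOn_theta₄ hd) j

theorem smoothOn_connForm (hd : IsData U h H) (i : Fin 4) :
    SmoothOn (total U) (connForm h H i) := by
  have h12 := contDiffOn_pi.1 (contDiffOn_connHor hd) i
  have h34 := contDiffOn_pi.1 (contDiffOn_connVert hd) i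
  have hx := contDiffOn_pi.1 (contDiffOn_connMixed hd 0) i
  have hy := contDiffOn_pi.1 (contDiffOn_connMixed hd 1) i
  intro a b
  fin_cases a <;> fin_cases b <;>
    first
    | exact contDiffOn_const
    | exact h12
    | exact h12.neg
    | exact h34
    | exact h34.neg
    | exact hx
    | exact hx.neg
    | exact hy
    | exact hy.neg

/-- `coframe h H` is an orthonormal coframe of `metric h H` with connection forms `connForm h H`. -/
theorem isMovingFrame (hd : IsData U h H) :
    IsMovingFrame (total U) (coframe h H) (fun q => (coframe h H q)⁻¹) (connForm h H) where
  smooth := smoothOn_coframe hd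
  smooth_dual := (smoothOn_coframe hd).inv fun _ hp => det_coframe_ne_zero hd hp
  smooth_conn := smoothOn_connForm hd
  mul_dual := fun _ hp => Matrix.mul_nonsing_inv _ (det_coframe_ne_zero hd hp).isUnit
  skew := fun p _ i => by
    ext a b
    fin_cases a <;> fin_cases b <;> simp [connForm]
  torsion := fun p hp a i j => by
    have h0 := (extd_horForm₀ hd hp).2 i j
    have h1 := (extd_horForm₁ hd hp).2 i j
    have h2 := (extd_theta₃ hd hp).2 i j
    have h3 := (extd_theta₄ hd hp).2 i j
    simp only [Matrix.add_apply, Matrix.sub_apply, Matrix.neg_apply, wedge_apply] at h0 h1 h2 h3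
    fin_cases a
    · refine h0.trans ?_
      simp [connForm, coframe, Matrix.mul_apply, Fin.sum_univ_four]
      ring
    · refine h1.trans ?_
      simp [connForm, coframe, Matrix.mul_apply, Fin.sum_univ_four]
      ring
    · refine h2.trans ?_
      simp [connForm, coframe, Matrix.mul_apply, Fin.sum_univ_four]
      ring
    · refine h3.trans ?_
      simp [connForm, coframe, Matrix.mul_apply, Fin.sum_univ_four]
      ring

/-! ### The curvature of the metric -/

/-- The holomorphic sectional curvature of the horizontal plane field `e₁ ∧ e₂`. -/
noncomputable def horCurv (h H : (Fin 2 → ℝ) → ℝ) (p : Fin 4 → ℝ) : ℝ :=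
  -(lap (fun q => Real.log (h q)) (base p) + 1 / 2 * H (base p) ^ 2
      + Real.cosh (p 2 / 2) ^ 2 * h (base p) ^ 2) / (Real.sinh (p 2 / 2) * h (base p)) ^ 2

/-- The curvature form `Ω₁₂ = K e₁ ∧ e₂ + ½ e₃ ∧ e₄`. -/
noncomputable def curv₁₂ (K : ℝ) : Matrix (Fin 4) (Fin 4) ℝ :=
  !![0, K, 0, 0; -K, 0, 0, 0; 0, 0, 0, 1 / 2; 0, 0, -1 / 2, 0]

/-- The curvature form `Ω₃₄ = ½ e₁ ∧ e₂ - e₃ ∧ e₄`. -/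
noncomputable def curv₃₄ : Matrix (Fin 4) (Fin 4) ℝ :=
  !![0, 1 / 2, 0, 0; -1 / 2, 0, 0, 0; 0, 0, 0, -1; 0, 0, 1, 0]

/-- The curvature form `Ω₁₄ = Ω₂₃ = -¼ (e₁ ∧ e₄ + e₂ ∧ e₃)`. -/
noncomputable def curv₁₄ : Matrix (Fin 4) (Fin 4) ℝ :=
  !![0, 0, 0, -1 / 4; 0, 0, -1 / 4, 0; 0, 1 / 4, 0, 0; 1 / 4, 0, 0, 0]

/-- The curvature form `Ω₂₄ = -Ω₁₃ = ¼ (e₁ ∧ e₃ - e₂ ∧ e₄)`. -/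
noncomputable def curv₂₄ : Matrix (Fin 4) (Fin 4) ℝ :=
  !![0, 0, 1 / 4, 0; 0, 0, 0, -1 / 4; -1 / 4, 0, 0, 0; 0, 1 / 4, 0, 0]

/-- The frame components `Ωᵃ_b(e_c, e_d)` of the curvature, for horizontal curvature `K`. -/
noncomputable def frameCurv (K : ℝ) : Fin 4 → Fin 4 → Matrix (Fin 4) (Fin 4) ℝ
  | 0, 1 => curv₁₂ K
  | 1, 0 => -curv₁₂ K
  | 0, 2 => -curv₂₄
  | 2, 0 => curv₂₄
  | 0, 3 => curv₁₄
  | 3, 0 => -curv₁₄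
  | 1, 2 => curv₁₄
  | 2, 1 => -curv₁₄
  | 1, 3 => curv₂₄
  | 3, 1 => -curv₂₄
  | 2, 3 => curv₃₄
  | 3, 2 => -curv₃₄
  | _, _ => 0

/-- Second structure equation for `ω₁₂`. The numerator of `horCurv` collects all the `dx ∧ dy`
terms, so no property of `h` beyond smoothness and positivity enters. -/
theorem extd_connHor (hd : IsData U h H) (hp : p ∈ total U) :
    HasExtd (connHor h H) (horCurv h H p • wedge (horForm h 0 p) (horForm h 1 p)
      + (1 / 2 : ℝ) • wedge (θ₃ H p) (θ₄ H p)
      + (2 : ℝ) • wedge (connMixed h 0 p) (connMixed h 1 p)) p := by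
  have h1 := (extd_formBase hd.isOpen hd.smooth_h hd.pos_h hp).sub
    (HasExtd.smul (hasGrad_const (1 / 2) p) (extd_formPhi hd hp))
  have h2 := h1.sub (HasExtd.smul (hasGrad_const (1 / 2) p) (extd_connVert hd hp))
  refine HasExtd.congr h2 ?_
  have hne : (Real.sinh (p 2 / 2) * h (base p)) ^ 2 ≠ 0 :=
    pow_ne_zero 2 (mul_ne_zero (sinh_half_neg hp).ne (hd.pos_h _ hp.1).ne')
  have hK : horCurv h H p * (Real.sinh (p 2 / 2) * h (base p)) ^ 2
      = -(lap (fun q => Real.log (h q)) (base p) + 1 / 2 * H (base p) ^ 2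
      + Real.cosh (p 2 / 2) ^ 2 * h (base p) ^ 2) := div_mul_cancel₀ _ hne
  ext i j
  simp only [wedge_apply, horForm, connMixed, Matrix.add_apply, Matrix.sub_apply,
    Matrix.smul_apply, Pi.smul_apply, Pi.zero_apply, smul_eq_mul]
  linear_combination (dcoord 0 i * dcoord 1 j - dcoord 1 i * dcoord 0 j)
    * (1 / 4 * h (base p) ^ 2 * Real.cosh_sq (p 2 / 2) - hK)

theorem frameCurv_skew (K : ℝ) (a b : Fin 4) : frameCurv K b a = -frameCurv K a b := by
  fin_cases a <;> fin_cases b <;> simp [frameCurv]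

/-- The curvature forms of the metric have constant frame components except for the horizontal
curvature `horCurv h H`. -/
theorem curvForm_connForm (hd : IsData U h H) (hp : p ∈ total U) (i j a b : Fin 4) :
    curvForm (connForm h H) i j p a b
      = ((coframe h H p)ᵀ * frameCurv (horCurv h H p) a b * coframe h H p) i j := by
  have h12 := (extd_connHor hd hp).2 i j
  have h34 := (extd_connVert hd hp).2 i j
  have h14 := (extd_connMixed₀ hd hp).2 i j
  have h24 := (extd_connMixed₁ hd hp).2 i j
  simp only [Matrix.add_apply, Matrix.sub_apply, Matrix.smul_apply, smul_eq_mul,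
    wedge_apply] at h12 h34 h14 h24
  have key : ∀ a b : Fin 4, a ≤ b → curvForm (connForm h H) i j p a b
      = ((coframe h H p)ᵀ * frameCurv (horCurv h H p) a b * coframe h H p) i j := by
    intro a b hab
    fin_cases a <;> fin_cases b <;>
      first
      | exact absurd hab (by decide)
      | simp [curvForm, pdMat, connForm, coframe, frameCurv, curv₁₂, curv₁₄, curv₂₄, curv₃₄,
          Matrix.mul_apply, Fin.sum_univ_four, pd_neg, pd_const]
    · ring
    · linear_combination h12
    · linear_combination -h24
    · linear_combination h14
    · ring
    · linear_combination h14
    · linear_combination h24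
    · ring
    · linear_combination h34
    · ring
  rcases le_total a b with hab | hab
  · exact key a b hab
  · have h1 := congrFun (congrFun
      ((isMovingFrame hd).curvForm_skew (isOpen_total hd.isOpen) hp i j) b) a
    rw [Matrix.transpose_apply, Matrix.neg_apply, key b a hab] at h1
    rw [h1, frameCurv_skew _ b a, Matrix.mul_neg, Matrix.neg_mul, Matrix.neg_apply]

end

section

variable {U : Set (Fin 2 → ℝ)} {h H : (Fin 2 → ℝ) → ℝ} {p : Fin 4 → ℝ} {ε : ℝ}

/-! ### The two Hermitian structures -/

/-- The complex structure of `ℝ⁴` with `e₁ ↦ e₂` and `e₃ ↦ ε e₄`, for `ε = ±1`. -/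
def stdJ (ε : ℝ) : Matrix (Fin 4) (Fin 4) ℝ :=
  !![0, -1, 0, 0; 1, 0, 0, 0; 0, 0, 0, -ε; 0, 0, ε, 0]

/-- The almost complex structure acting on the frame of `metric h H` as `stdJ ε`. -/
noncomputable def frameJ (h H : (Fin 2 → ℝ) → ℝ) (ε : ℝ) (p : Fin 4 → ℝ) :
    Matrix (Fin 4) (Fin 4) ℝ :=
  (coframe h H p)⁻¹ * stdJ ε * coframe h H p

theorem stdJ_mul_self (hε : ε * ε = 1) : stdJ ε * stdJ ε = -1 := by
  ext a b
  fin_cases a <;> fin_cases b <;> simp [stdJ, Matrix.mul_apply, Fin.sum_univ_four, hε]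

theorem stdJ_transpose (ε : ℝ) : (stdJ ε)ᵀ = -stdJ ε := by
  ext a b
  fin_cases a <;> fin_cases b <;> simp [stdJ]

theorem coframe_mul_frameJ (hd : IsData U h H) (hp : p ∈ total U) :
    coframe h H p * frameJ h H ε p = stdJ ε * coframe h H p := by
  rw [frameJ, Matrix.mul_assoc, ← Matrix.mul_assoc, (isMovingFrame hd).mul_dual p hp,
    Matrix.one_mul]

theorem coframe_mulVec_frameJ (hd : IsData U h H) (hp : p ∈ total U) (X : Fin 4 → ℝ) :
    coframe h H p *ᵥ (frameJ h H ε p *ᵥ X) = stdJ ε *ᵥ (coframe h H p *ᵥ X) := by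
  rw [Matrix.mulVec_mulVec, coframe_mul_frameJ hd hp, Matrix.mulVec_mulVec]

theorem frameJ_transpose_mul (hd : IsData U h H) (hp : p ∈ total U) :
    (frameJ h H ε p)ᵀ * (coframe h H p)ᵀ = (coframe h H p)ᵀ * (stdJ ε)ᵀ := by
  rw [← Matrix.transpose_mul, coframe_mul_frameJ hd hp, Matrix.transpose_mul]

theorem kahlerForm_frameJ_eq (hd : IsData U h H) (hp : p ∈ total U) :
    kahlerForm (metric h H) (frameJ h H ε) p
      = (coframe h H p)ᵀ * (stdJ ε)ᵀ * coframe h H p := by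
  rw [kahlerForm, metric_eq, ← Matrix.mul_assoc, frameJ_transpose_mul hd hp]

theorem kahlerForm_frameJ (hd : IsData U h H) (hp : p ∈ total U) :
    kahlerForm (metric h H) (frameJ h H ε) p
      = Real.sinh (p 2 / 2) ^ 2 • volBase h p + ε • wedge (θ₃ H p) (θ₄ H p) := by
  rw [kahlerForm_frameJ_eq hd hp]
  ext i j
  simp [coframe, horForm, stdJ, volBase, wedge_apply, Matrix.mul_apply, Fin.sum_univ_four]
  ring

/-- Half the commutator of the connection forms with `stdJ 1`, where `u` and `v` are the values of
`ω₁₄` and `ω₂₄`; see `connForm_comm`. -/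
def commMat (u v : ℝ) : Matrix (Fin 4) (Fin 4) ℝ :=
  !![0, 0, u, v; 0, 0, v, -u; -u, -v, 0, 0; -v, u, 0, 0]

/-- The frame components of the covariant derivative of `frameJ h H ε`; they vanish for `ε = -1`. -/
theorem connForm_comm (h H : (Fin 2 → ℝ) → ℝ) (ε : ℝ) (i : Fin 4) (p : Fin 4 → ℝ) :
    connForm h H i p * stdJ ε - stdJ ε * connForm h H i p
      = (1 + ε) • commMat (connMixed h 0 p i) (connMixed h 1 p i) := by
  ext a b
  fin_cases a <;> fin_cases b <;>
    simp [connForm, stdJ, commMat] <;> ring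

theorem stdJ_mul_commMat (hε : ε * ε = 1) (u v : ℝ) :
    stdJ ε * ((1 + ε) • commMat u v) = (1 + ε) • commMat (-v) u := by
  ext a b
  fin_cases a <;> fin_cases b <;>
    simp [stdJ, commMat, Matrix.mul_apply, Fin.sum_univ_four] <;> grind

theorem isRiemannianMetric (hd : IsData U h H) : IsRiemannianMetric (total U) (metric h H) where
  smooth := by
    rw [metric_eq]
    exact (smoothOn_coframe hd).transpose.mul (smoothOn_coframe hd)
  posDef := fun p hp => by
    rw [metric_eq]
    have := Matrix.PosDef.conjTranspose_mul_self (coframe h H p)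
      (Matrix.mulVec_injective_of_isUnit
        ((Matrix.isUnit_iff_isUnit_det _).2 (det_coframe_ne_zero hd hp).isUnit))
    rwa [Matrix.conjTranspose_eq_transpose_of_trivial] at this

theorem isHermitian_frameJ (hd : IsData U h H) (hε : ε * ε = 1) :
    IsHermitian (total U) (metric h H) (frameJ h H ε) where
  metric := isRiemannianMetric hd
  smooth := ((isMovingFrame hd).smooth_dual.mul (smoothOn_const _ _)).mul (smoothOn_coframe hd)
  sq := fun p hp => by
    rw [frameJ, Matrix.mul_assoc, ← frameJ, coframe_mul_frameJ hd hp, Matrix.mul_assoc,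
      ← Matrix.mul_assoc (stdJ ε), stdJ_mul_self hε, Matrix.neg_mul, Matrix.mul_neg,
      Matrix.one_mul, (isMovingFrame hd).dual_mul hp]
  orthogonal := fun p hp X Y => by
    rw [metric_eq, bilin_transpose_mul_self, bilin_transpose_mul_self, coframe_mulVec_frameJ hd hp,
      coframe_mulVec_frameJ hd hp, ← bilin_one, ← bilin_one, bilin_mulVec, stdJ_transpose,
      Matrix.mul_one, Matrix.neg_mul, stdJ_mul_self hε, neg_neg]
  integrable := fun p hp k i j => by
    have hE : ∀ a i, ∑ l, frameJ h H ε p l i * coframe h H p a l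
        = (stdJ ε * coframe h H p) a i := fun a i => by
      rw [← coframe_mul_frameJ hd hp, Matrix.mul_apply]
      exact Finset.sum_congr rfl fun l _ => mul_comm _ _
    have hS : Real.sinh (p 2 / 2) ≠ 0 := (sinh_half_neg hp).ne
    -- The mixed connection forms are multiples of `e₁` and `e₂`, which `J` permutes up to sign.
    have hu : ∀ l, connMixed h 0 p l
        = 1 / 2 * Real.cosh (p 2 / 2) / Real.sinh (p 2 / 2) * coframe h H p 0 l := fun l => by
      simp [connMixed, coframe, horForm]
      field_simp
    have hv : ∀ l, connMixed h 1 p l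
        = 1 / 2 * Real.cosh (p 2 / 2) / Real.sinh (p 2 / 2) * coframe h H p 1 l := fun l => by
      simp [connMixed, coframe, horForm]
      field_simp
    refine (isMovingFrame hd).nijenhuis_eq_zero (isOpen_total hd.isOpen) hp (stdJ_mul_self hε)
      (fun i => ?_) k i j
    have hc : ∀ (s : Fin 4 → ℝ) (u v : Fin 4 → ℝ), ∑ l, s l • ((1 + ε) • commMat (u l) (v l))
        = (1 + ε) • commMat (∑ l, s l * u l) (∑ l, s l * v l) := fun s u v => by
      ext a b
      fin_cases a <;> fin_cases b <;>
        simp [commMat, Matrix.sum_apply, Fin.sum_univ_four] <;> ring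
    simp only [connForm_comm]
    rw [stdJ_mul_commMat hε]
    refine (hc (fun l => frameJ h H ε p l i) _ _).trans ?_
    have e0 : ∑ l, frameJ h H ε p l i * connMixed h 0 p l = -connMixed h 1 p i := by
      simp only [hu, hv, mul_left_comm _ (1 / 2 * Real.cosh (p 2 / 2) / Real.sinh (p 2 / 2)),
        ← Finset.mul_sum, hE]
      simp [stdJ, Matrix.mul_apply, Fin.sum_univ_four]
    have e1 : ∑ l, frameJ h H ε p l i * connMixed h 1 p l = connMixed h 0 p i := by
      simp only [hu, hv, mul_left_comm _ (1 / 2 * Real.cosh (p 2 / 2) / Real.sinh (p 2 / 2)),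
        ← Finset.mul_sum, hE]
      simp [stdJ, Matrix.mul_apply, Fin.sum_univ_four]
    rw [e0, e1]

theorem extd_congr {n : ℕ} {M : Set (Fin n → ℝ)} (hM : IsOpen M)
    {w w' : (Fin n → ℝ) → Matrix (Fin n) (Fin n) ℝ} (hw : ∀ q ∈ M, w q = w' q) {p : Fin n → ℝ}
    (hp : p ∈ M) (i j k : Fin n) : extd w p i j k = extd w' p i j k := by
  have h : ∀ i j k, pd i (fun q => w q j k) p = pd i (fun q => w' q j k) p := fun i j k =>
    pd_congr hM (fun q hq => by rw [hw q hq]) hp i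
  rw [extd, extd, h, h, h]

/-- The factor `1 + ε` makes the Kähler form closed for `ε = -1` and leaves the Lee form for
`ε = 1`. -/
theorem extd_kahlerForm (hd : IsData U h H) (hp : p ∈ total U) (i j k : Fin 4) :
    extd (kahlerForm (metric h H) (frameJ h H ε)) p i j k
      = -(1 + ε) * (
        ((coframe h H p)ᵀ * commMat (connMixed h 0 p i) (connMixed h 1 p i) * coframe h H p) j k
        + ((coframe h H p)ᵀ * commMat (connMixed h 0 p j) (connMixed h 1 p j) * coframe h H p) k i
        + ((coframe h H p)ᵀ * commMat (connMixed h 0 p k) (connMixed h 1 p k)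
          * coframe h H p) i j) := by
  have hM := isOpen_total hd.isOpen
  have hc : ∀ i, connForm h H i p * (stdJ ε)ᵀ - (stdJ ε)ᵀ * connForm h H i p
      = -(1 + ε) • commMat (connMixed h 0 p i) (connMixed h 1 p i) := fun i => by
    rw [neg_smul, ← connForm_comm h H ε i p, stdJ_transpose]
    noncomm_ring
  rw [extd_congr hM (fun q hq => kahlerForm_frameJ_eq hd hq) hp, (isMovingFrame hd).extd_eq hM hp
    (by rw [Matrix.transpose_transpose, stdJ_transpose, neg_neg])]
  simp only [hc, Matrix.mul_smul, Matrix.smul_mul, Matrix.smul_apply, smul_eq_mul]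
  ring

theorem isKahler_frameJ (hd : IsData U h H) :
    IsKahler (total U) (metric h H) (frameJ h H (-1)) where
  hermitian := isHermitian_frameJ hd (by norm_num)
  closed := fun p hp i j k => by
    rw [extd_kahlerForm hd hp]
    ring

theorem isLeeForm (hd : IsData U h H) : IsLeeForm (total U) (metric h H) (frameJ h H 1)
    (fun p => (Real.cosh (p 2 / 2) / Real.sinh (p 2 / 2)) • θ₄ H p) := by
  refine ⟨((contDiff_half 2).cosh.contDiffOn.div (contDiff_half 2).sinh.contDiffOn
    fun q hq => (sinh_half_neg hq).ne).smul (contDiffOn_theta₄ hd), fun p hp i j k => ?_⟩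
  rw [extd_kahlerForm hd hp, kahlerForm_frameJ hd hp]
  have hr : Real.cosh (p 2 / 2)
      = Real.cosh (p 2 / 2) / Real.sinh (p 2 / 2) * Real.sinh (p 2 / 2) :=
    (div_mul_cancel₀ _ (sinh_half_neg hp).ne).symm
  simp [wedgeTwo, coframe, horForm, connMixed, commMat, volBase, wedge_apply, Matrix.mul_apply,
    Fin.sum_univ_four]
  generalize Real.cosh (p 2 / 2) / Real.sinh (p 2 / 2) = r at *
  rw [hr]
  ring

/-! ### Orientations -/

/-- `det (x, Jx, y, Jy)` has the sign of `ε`: for `ε = 1` it is the squared modulus of the complex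
determinant of `(x, y)`. -/
theorem det_stdJ (hε : ε * ε = 1) (x y : Fin 4 → ℝ) :
    (Matrix.of ![x, stdJ ε *ᵥ x, y, stdJ ε *ᵥ y]).det
      = ε * ((x 0 * y 2 - x 1 * ε * y 3 - x 2 * y 0 + ε * x 3 * y 1) ^ 2
        + (x 0 * ε * y 3 + x 1 * y 2 - ε * x 3 * y 0 - x 2 * y 1) ^ 2) := by
  simp [stdJ, dotProduct, Matrix.det_succ_row_zero, Fin.sum_univ_succ,
    Fin.succAbove]
  grind

theorem det_frame (hd : IsData U h H) (hp : p ∈ total U) (X Y : Fin 4 → ℝ) :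
    (Matrix.of ![X, frameJ h H ε p *ᵥ X, Y, frameJ h H ε p *ᵥ Y]).det * (coframe h H p).det
      = (Matrix.of ![coframe h H p *ᵥ X, stdJ ε *ᵥ (coframe h H p *ᵥ X), coframe h H p *ᵥ Y,
          stdJ ε *ᵥ (coframe h H p *ᵥ Y)]).det := by
  rw [← Matrix.det_transpose (coframe h H p), ← Matrix.det_mul, ← coframe_mulVec_frameJ hd hp,
    ← coframe_mulVec_frameJ hd hp]
  congr 1
  ext a b
  fin_cases a <;>
    simp only [Matrix.mul_apply, Matrix.of_apply, Matrix.transpose_apply]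
  all_goals exact Finset.sum_congr rfl fun _ _ => mul_comm _ _

theorem oppositeOrientation (hd : IsData U h H) :
    OppositeOrientation (total U) (frameJ h H 1) (frameJ h H (-1)) := by
  intro p hp X Y Z W h1 h2
  have hE := det_coframe_ne_zero hd hp
  have n1 : (Matrix.of ![X, frameJ h H 1 p *ᵥ X, Y, frameJ h H 1 p *ᵥ Y]).det ≠ 0 :=
    ((Matrix.isUnit_iff_isUnit_det _).1 (Matrix.linearIndependent_rows_iff_isUnit.1 h1)).ne_zero
  have n2 : (Matrix.of ![Z, frameJ h H (-1) p *ᵥ Z, W, frameJ h H (-1) p *ᵥ W]).det ≠ 0 :=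
    ((Matrix.isUnit_iff_isUnit_det _).1 (Matrix.linearIndependent_rows_iff_isUnit.1 h2)).ne_zero
  have e1 := det_frame (ε := 1) hd hp X Y
  have e2 := det_frame (ε := -1) hd hp Z W
  rw [det_stdJ (by norm_num)] at e1 e2
  have p1 : 0 < (Matrix.of ![X, frameJ h H 1 p *ᵥ X, Y, frameJ h H 1 p *ᵥ Y]).det
      * (coframe h H p).det :=
    lt_of_le_of_ne (by rw [e1]; positivity) (mul_ne_zero n1 hE).symm
  have p2 : (Matrix.of ![Z, frameJ h H (-1) p *ᵥ Z, W, frameJ h H (-1) p *ᵥ W]).det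
      * (coframe h H p).det < 0 :=
    lt_of_le_of_ne (by rw [e2, neg_one_mul, neg_nonpos]; positivity) (mul_ne_zero n2 hE)
  have := mul_neg_of_pos_of_neg p1 p2
  have hsq : 0 < (coframe h H p).det ^ 2 := by positivity
  refine neg_of_mul_neg_left (b := (coframe h H p).det ^ 2) ?_ hsq.le
  linarith

/-! ### Ricci tensor and holomorphic curvature -/

theorem sum_frameCurv (K : ℝ) : (Matrix.of fun d b => ∑ a, frameCurv K a b a d)
    = Matrix.diagonal ![K - 1 / 2, K - 1 / 2, -3 / 2, -3 / 2] := by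
  ext d b
  rw [Matrix.of_apply, Fin.sum_univ_four]
  fin_cases b <;> fin_cases d <;>
    simp [frameCurv, curv₁₂, curv₁₄, curv₂₄, curv₃₄] <;> ring

/-- The Ricci tensor is a multiple of the identity on each of the two `J`-invariant planes spanned
by `e₁, e₂` and `e₃, e₄`. -/
theorem ricci_metric (hd : IsData U h H) (hp : p ∈ total U) :
    ricci (metric h H) p = (coframe h H p)ᵀ * Matrix.diagonal
      ![horCurv h H p - 1 / 2, horCurv h H p - 1 / 2, -3 / 2, -3 / 2] * coframe h H p := by
  rw [metric_eq, (isMovingFrame hd).ricci_eq (isOpen_total hd.isOpen) hp (curvForm_connForm hd hp),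
    sum_frameCurv]

theorem stdJ_transpose_mul_diagonal (hε : ε * ε = 1) (r s : ℝ) :
    (stdJ ε)ᵀ * Matrix.diagonal ![r, r, s, s] * stdJ ε = Matrix.diagonal ![r, r, s, s] := by
  ext d b
  fin_cases d <;> fin_cases b <;> simp [stdJ, Matrix.mul_apply, Fin.sum_univ_four] <;> grind

theorem ricciInvariant (hd : IsData U h H) :
    RicciInvariant (total U) (metric h H) (frameJ h H 1) := by
  intro p hp X Y
  have hJ := stdJ_transpose_mul_diagonal (ε := 1) (by norm_num) (horCurv h H p - 1 / 2) (-3 / 2)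
  rw [ricci_metric hd hp, ← bilin_mulVec, ← bilin_mulVec, coframe_mulVec_frameJ hd hp,
    coframe_mulVec_frameJ hd hp, bilin_mulVec, hJ]

/-- The holomorphic curvature in terms of the squared lengths of the horizontal and vertical
components. -/
theorem holCurvature_frameJ (hd : IsData U h H) (hp : p ∈ total U) (X : Fin 4 → ℝ) :
    holCurvature (metric h H) (frameJ h H (-1)) p X
      = horCurv h H p * ((coframe h H p *ᵥ X) 0 ^ 2 + (coframe h H p *ᵥ X) 1 ^ 2) ^ 2
        - 2 * ((coframe h H p *ᵥ X) 0 ^ 2 + (coframe h H p *ᵥ X) 1 ^ 2)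
          * ((coframe h H p *ᵥ X) 2 ^ 2 + (coframe h H p *ᵥ X) 3 ^ 2)
        - ((coframe h H p *ᵥ X) 2 ^ 2 + (coframe h H p *ᵥ X) 3 ^ 2) ^ 2 := by
  rw [holCurvature, metric_eq, (isMovingFrame hd).bilin_curvature (isOpen_total hd.isOpen) hp
    (curvForm_connForm hd hp), coframe_mulVec_frameJ hd hp]
  generalize coframe h H p *ᵥ X = x
  simp [bilin, frameCurv, curv₁₂, curv₁₄, curv₂₄, curv₃₄, stdJ, Matrix.mulVec, dotProduct,
    Fin.sum_univ_four]
  ring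

theorem mem_vertical {X : Fin 4 → ℝ} : X ∈ vertical p ↔ X 0 = 0 ∧ X 1 = 0 := by
  rw [vertical, Submodule.mem_span_pair]
  constructor
  · rintro ⟨a, b, rfl⟩
    simp
  · rintro ⟨h0, h1⟩
    refine ⟨X 2, X 3, ?_⟩
    ext i
    fin_cases i <;> simp [h0, h1]

theorem mem_vertical_iff_coframe (hd : IsData U h H) (hp : p ∈ total U) {X : Fin 4 → ℝ} :
    X ∈ vertical p ↔ (coframe h H p *ᵥ X) 0 = 0 ∧ (coframe h H p *ᵥ X) 1 = 0 := by
  have hS : Real.sinh (p 2 / 2) ≠ 0 := (sinh_half_neg hp).ne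
  have hh : h (base p) ≠ 0 := (hd.pos_h _ hp.1).ne'
  rw [mem_vertical]
  simp [coframe, horForm, Matrix.mulVec, dotProduct, Fin.sum_univ_four, dcoord, hS, hh]

/-- The orthogonal projection onto the vertical distribution keeps the last two frame
components. -/
theorem coframe_orthProj (hd : IsData U h H) (hp : p ∈ total U) {X X' : Fin 4 → ℝ}
    (hX : IsOrthProj (metric h H p) (vertical p) X X') :
    bilin (metric h H p) X' X'
      = (coframe h H p *ᵥ X) 2 ^ 2 + (coframe h H p *ᵥ X) 3 ^ 2 := by
  obtain ⟨hv, ho⟩ := hX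
  have h01 := (mem_vertical_iff_coframe hd hp).1 hv
  have hk : ∀ a : Fin 4, 2 ≤ a → (coframe h H p *ᵥ X') a = (coframe h H p *ᵥ X) a := fun a ha => by
    have hE : coframe h H p *ᵥ ((coframe h H p)⁻¹ *ᵥ Pi.single a 1) = Pi.single a 1 := by
      rw [Matrix.mulVec_mulVec, (isMovingFrame hd).mul_dual p hp, Matrix.one_mulVec]
    have hm : (coframe h H p)⁻¹ *ᵥ Pi.single a 1 ∈ vertical p := by
      rw [mem_vertical_iff_coframe hd hp, hE]
      fin_cases a <;> simp_all
    have := ho _ hm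
    rw [metric_eq, bilin_transpose_mul_self, hE, Matrix.mulVec_sub, dotProduct_single, mul_one,
      Pi.sub_apply] at this
    linarith
  rw [metric_eq, bilin_transpose_mul_self]
  simp [dotProduct, Fin.sum_univ_four, h01.1, h01.2, hk 2 (by decide), hk 3 (by decide)]
  ring

theorem isQCH (hd : IsData U h H) :
    IsQCH (total U) (metric h H) (frameJ h H (-1)) vertical where
  kahler := isKahler_frameJ hd
  distribution := fun p hp => by
    refine ⟨total U, isOpen_total hd.isOpen, hp, subset_rfl,
      ![fun _ => Pi.single 2 1, fun _ => Pi.single 3 1], fun a => ?_, fun q _ => ⟨?_, ?_⟩⟩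
    · fin_cases a <;> exact contDiffOn_const
    · have : (fun a => (![fun _ => Pi.single 2 1, fun _ => Pi.single 3 1] :
          Fin 2 → (Fin 4 → ℝ) → Fin 4 → ℝ) a q) = ![Pi.single 2 1, Pi.single 3 1] := by
        ext a; fin_cases a <;> rfl
      rw [this, LinearIndependent.pair_iff]
      intro s t hst
      exact ⟨by simpa using congrFun hst 2, by simpa using congrFun hst 3⟩
    · rw [vertical]
      congr 1
      ext X
      simp only [Set.mem_range, Set.mem_insert_iff, Set.mem_singleton_iff,
        Fin.exists_fin_two]
      simp only [Matrix.cons_val, eq_comm (b := X)]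
  invariant := fun p hp X hX => by
    rw [mem_vertical_iff_coframe hd hp] at hX ⊢
    rw [coframe_mulVec_frameJ hd hp]
    generalize coframe h H p *ᵥ X = x at hX ⊢
    simp [stdJ, Matrix.mulVec, dotProduct, Fin.sum_univ_four, hX]
  curvature := fun p hp X X' Y Y' h1 h2 hX hY hXY => by
    rw [coframe_orthProj hd hp hX, coframe_orthProj hd hp hY,
      Real.sqrt_inj (by positivity) (by positivity)] at hXY
    have hsq : ∀ Z, bilin (metric h H p) Z Z = 1 →
        (coframe h H p *ᵥ Z) 0 ^ 2 + (coframe h H p *ᵥ Z) 1 ^ 2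
          = 1 - ((coframe h H p *ᵥ Z) 2 ^ 2 + (coframe h H p *ᵥ Z) 3 ^ 2) := fun Z hZ => by
      rw [metric_eq, bilin_transpose_mul_self] at hZ
      rw [← hZ]
      simp [dotProduct, Fin.sum_univ_four]
      ring
    rw [holCurvature_frameJ hd hp, holCurvature_frameJ hd hp, hsq X h1, hsq Y h2, hXY]

/-! ### Non-closedness of the Lee form -/

/-- Wedging with the fundamental form of a Hermitian structure in dimension four is injective on
covectors. -/
theorem eq_zero_of_wedgeTwo {E F : Matrix (Fin 4) (Fin 4) ℝ} (hEF : E * F = 1)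
    {a : Fin 4 → ℝ} (ha : ∀ i j k, wedgeTwo a (Eᵀ * (stdJ 1)ᵀ * E) i j k = 0) : a = 0 := by
  have hFE : F * E = 1 := mul_eq_one_comm.mp hEF
  -- `x` is the vector of frame components of `a`.
  set x : Fin 4 → ℝ := a ᵥ* F with hx
  have hax : a = x ᵥ* E := by rw [hx, Matrix.vecMul_vecMul, hFE, Matrix.vecMul_one]
  have key : ∀ X Y Z : Fin 4 → ℝ, (x ⬝ᵥ (E *ᵥ X)) * bilin (stdJ 1)ᵀ (E *ᵥ Y) (E *ᵥ Z)
      + (x ⬝ᵥ (E *ᵥ Y)) * bilin (stdJ 1)ᵀ (E *ᵥ Z) (E *ᵥ X)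
      + (x ⬝ᵥ (E *ᵥ Z)) * bilin (stdJ 1)ᵀ (E *ᵥ X) (E *ᵥ Y) = 0 := fun X Y Z => by
    simp only [Matrix.dotProduct_mulVec, ← hax, bilin_mulVec]
    generalize hw : Eᵀ * (stdJ 1)ᵀ * E = w at ha
    have : ∑ i, ∑ j, ∑ k, wedgeTwo a w i j k * X i * Y j * Z k = 0 := by simp [ha]
    rw [← this]
    have hs : ∀ X Y Z : Fin 4 → ℝ, (a ⬝ᵥ X) * bilin w Y Z
        = ∑ i, ∑ j, ∑ k, a i * w j k * X i * Y j * Z k := fun X Y Z => by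
      rw [bilin_eq_sum, dotProduct, Finset.sum_mul]
      simp only [Finset.mul_sum]
      exact Finset.sum_congr rfl fun i _ => Finset.sum_congr rfl fun j _ =>
        Finset.sum_congr rfl fun k _ => by ring
    have hrot : ∀ f : Fin 4 → Fin 4 → Fin 4 → ℝ,
        ∑ i, ∑ j, ∑ k, f i j k = ∑ i, ∑ j, ∑ k, f j k i := fun f => by
      rw [Finset.sum_congr rfl fun i _ => Finset.sum_comm, Finset.sum_comm]
    rw [hs, hs, hs, hrot (fun i j k => a i * w j k * Y i * Z j * X k),
      ← hrot (fun i j k => a k * w i j * Z k * X i * Y j)]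
    simp only [wedgeTwo, ← Finset.sum_add_distrib]
    exact Finset.sum_congr rfl fun i _ => Finset.sum_congr rfl fun j _ =>
      Finset.sum_congr rfl fun k _ => by ring
  have key' : ∀ u v w : Fin 4 → ℝ, (x ⬝ᵥ u) * bilin (stdJ 1)ᵀ v w
      + (x ⬝ᵥ v) * bilin (stdJ 1)ᵀ w u + (x ⬝ᵥ w) * bilin (stdJ 1)ᵀ u v = 0 := fun u v w => by
    have := key (F *ᵥ u) (F *ᵥ v) (F *ᵥ w)
    simpa only [Matrix.mulVec_mulVec, hEF, Matrix.one_mulVec] using this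
  have h0 := key' (Pi.single 0 1) (Pi.single 2 1) (Pi.single 3 1)
  have h1 := key' (Pi.single 1 1) (Pi.single 2 1) (Pi.single 3 1)
  have h2 := key' (Pi.single 2 1) (Pi.single 0 1) (Pi.single 1 1)
  have h3 := key' (Pi.single 3 1) (Pi.single 0 1) (Pi.single 1 1)
  simp [bilin, stdJ, Matrix.mulVec, dotProduct, Fin.sum_univ_four] at h0 h1 h2 h3
  have hx0 : x = 0 := by
    ext a
    fin_cases a <;> assumption
  rw [hax, hx0, Matrix.zero_vecMul]

/-- A conformal factor making the metric Kähler is a potential of `-2θ`. -/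
theorem pd_conformal_factor (hd : IsData U h H) {V : Set (Fin 4 → ℝ)} (hV : IsOpen V)
    (hVU : V ⊆ total U) {σ : (Fin 4 → ℝ) → ℝ} (hσ : ContDiffOn ℝ ∞ σ V)
    (hK : IsKahler V (fun q => Real.exp (σ q) • metric h H q) (frameJ h H 1)) (hp : p ∈ V)
    (i : Fin 4) :
    pd i σ p = -2 * (Real.cosh (p 2 / 2) / Real.sinh (p 2 / 2)) * θ₄ H p i := by
  have hpU := hVU hp
  have hσd : DifferentiableAt ℝ σ p := (hσ.contDiffAt (hV.mem_nhds hp)).differentiableAt (by simp)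
  have hform : ∀ q, kahlerForm (fun q => Real.exp (σ q) • metric h H q) (frameJ h H 1) q
      = Real.exp (σ q) • kahlerForm (metric h H) (frameJ h H 1) q := fun q => by
    simp [kahlerForm]
  have hΩ : SmoothOn (total U) (kahlerForm (metric h H) (frameJ h H 1)) :=
    (isHermitian_frameJ hd (by norm_num)).smooth.transpose.mul (isRiemannianMetric hd).smooth
  have hpd : ∀ i j k,
      pd i (fun q => (Real.exp (σ q) • kahlerForm (metric h H) (frameJ h H 1) q) j k) p
      = Real.exp (σ p) * (pd i σ p * kahlerForm (metric h H) (frameJ h H 1) p j k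
        + pd i (fun q => kahlerForm (metric h H) (frameJ h H 1) q j k) p) := fun i j k => by
    simp only [Matrix.smul_apply, smul_eq_mul]
    rw [pd_mul hσd.exp (hΩ.differentiableAt (isOpen_total hd.isOpen) hpU j k), pd,
      fderiv_exp hσd]
    simp only [smul_apply, smul_eq_mul, pd]
    ring
  set a : Fin 4 → ℝ := fun i =>
    pd i σ p + 2 * (Real.cosh (p 2 / 2) / Real.sinh (p 2 / 2)) * θ₄ H p i with ha
  have hzero : ∀ i j k, wedgeTwo a (kahlerForm (metric h H) (frameJ h H 1) p) i j k = 0 :=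
    fun i j k => by
      have h1 := hK.closed p hp i j k
      have h2 := (isLeeForm hd).2 p hpU i j k
      rw [funext hform] at h1
      simp only [extd, hpd] at h1 h2
      have h3 := (Real.exp_pos (σ p)).ne'
      rw [← mul_add, ← mul_add, mul_eq_zero, or_iff_right h3] at h1
      simp only [wedgeTwo, Pi.smul_apply, smul_eq_mul, ha] at h1 h2 ⊢
      linear_combination h1 - h2
  rw [kahlerForm_frameJ_eq hd hpU] at hzero
  have := congrFun (eq_zero_of_wedgeTwo ((isMovingFrame hd).mul_dual p hpU) hzero) i
  rw [ha] at this
  simp only [Pi.zero_apply] at this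
  linarith

/-- If the metric were conformally Kähler, `θ` would be locally exact; but
`dθ(∂_t, ∂_x) = coth (z/2) sin t H`. -/
theorem not_isLCK (hd : IsData U h H) (hne : U.Nonempty) :
    ¬ IsLCK (total U) (metric h H) (frameJ h H 1) := by
  intro hL
  obtain ⟨q, hq⟩ := hne
  set p : Fin 4 → ℝ := ![q 0, q 1, -1, Real.pi / 2] with hpdef
  have hb : base p = q := by
    ext i
    fin_cases i <;> simp [base, hpdef]
  have hp : p ∈ total U := ⟨by rwa [hb], by simp [hpdef]⟩
  obtain ⟨V, hV, hpV, hVU, σ, hσ, hK⟩ := hL p hp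
  have hσ' := fun i q hq => pd_conformal_factor hd hV hVU hσ hK (p := q) hq i
  have hcomm := pd_pd_comm hV hσ hpV 3 0
  have h3 : pd 0 (pd 3 σ) p = 0 := by
    rw [pd_congr hV (f' := fun _ => 0) (fun q hq => ?_) hpV 0, pd_const]
    rw [hσ' 3 q hq]
    simp [θ₄, dcoord]
  have h0 : pd 3 (pd 0 σ) p
      = -(2 * (Real.cosh (p 2 / 2) / Real.sinh (p 2 / 2)) * H (base p)) := by
    have hC : HasGrad (fun q : Fin 4 → ℝ => Real.cosh (q 2 / 2) / Real.sinh (q 2 / 2)) _ p :=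
      hasGrad_comp_dcoord (k := fun z => Real.cosh (z / 2) / Real.sinh (z / 2))
        ((((hasDerivAt_id' (p 2)).div_const 2).cosh).div
          (((hasDerivAt_id' (p 2)).div_const 2).sinh) (sinh_half_neg hp).ne)
    have hg := (((hasGrad_const 2 p).mul hC).mul
      (hasGrad_comp_dcoord (Real.hasDerivAt_cos (p 3)))).mul
      (hasGrad_pos hd.isOpen hd.smooth_H hd.pos_H hp)
    rw [pd_congr hV (f' := fun q => 2 * (Real.cosh (q 2 / 2) / Real.sinh (q 2 / 2))
      * Real.cos (q 3) * H (base q)) (fun q hq => ?_) hpV 3, hg.2 3]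
    · have ht : p 3 = Real.pi / 2 := by simp [hpdef]
      simp [dcoord, ht]
      ring
    · rw [hσ' 0 q hq]
      simp [θ₄, dcoord]
      ring
  rw [h0, h3] at hcomm
  have hHp := (hd.pos_H _ hp.1).ne'
  have hS := (sinh_half_neg hp).ne
  have hC := (Real.cosh_pos (p 2 / 2)).ne'
  exact neg_ne_zero.2 (mul_ne_zero (mul_ne_zero two_ne_zero (div_ne_zero hC hS)) hHp) hcomm

end

end KahlerSurface

theorem theorem3 (U : Set (Fin 2 → ℝ)) (hU : IsOpen U) (hne : U.Nonempty)
    (h H : (Fin 2 → ℝ) → ℝ)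
    (hh : ContDiffOn ℝ ∞ h U) (hpos : ∀ q ∈ U, 0 < h q)
    (hH : ContDiffOn ℝ ∞ H U) (Hpos : ∀ q ∈ U, 0 < H q)
    (heq : ∀ q ∈ U, lap (fun q => Real.log (H q)) q = (1 / 2) * h q ^ 2 + H q ^ 2) :
    ∃ Jbar J : (Fin 4 → ℝ) → Matrix (Fin 4) (Fin 4) ℝ,
      -- `Jbar` is a Kähler structure with the stated Kähler form
      (IsKahler (total U) (metric h H) Jbar ∧
        ∀ p ∈ total U, kahlerForm (metric h H) Jbar p
          = Real.sinh (p 2 / 2) ^ 2 • volBase h p + wedge (θ₄ H p) (θ₃ H p)) ∧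
      -- `J` is a Hermitian structure with the stated Kähler form, opposite to `Jbar`
      (IsHermitian (total U) (metric h H) J ∧
        ∀ p ∈ total U, kahlerForm (metric h H) J p
          = Real.sinh (p 2 / 2) ^ 2 • volBase h p + wedge (θ₃ H p) (θ₄ H p)) ∧
      OppositeOrientation (total U) J Jbar ∧
      RicciInvariant (total U) (metric h H) J ∧
      ¬ IsLCK (total U) (metric h H) J ∧
      -- the Lee form is `-α θ₄` with `α = -coth (z/2)`
      IsLeeForm (total U) (metric h H) J
        (fun p => (Real.cosh (p 2 / 2) / Real.sinh (p 2 / 2)) • θ₄ H p) ∧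
      IsQCH (total U) (metric h H) Jbar vertical := by
  have hd : IsData U h H := ⟨hU, hh, hpos, hH, Hpos, heq⟩
  refine ⟨frameJ h H (-1), frameJ h H 1, ⟨isKahler_frameJ hd, fun p hp => ?_⟩,
    ⟨isHermitian_frameJ hd (by norm_num), fun p hp => ?_⟩, oppositeOrientation hd,
    ricciInvariant hd, not_isLCK hd hne, isLeeForm hd, isQCH hd⟩
  · rw [kahlerForm_frameJ hd hp, neg_one_smul, wedge, wedge, neg_sub]
  · rw [kahlerForm_frameJ hd hp, one_smul]
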